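/- **Setting.** Let $n\ge 1$, $m\ge 2$, and let $\varepsilon\in(0,1/2]$ with $1/\varepsilon\in\mathbb{Z}$. There are agents $N=\{1,\dots,n\}$ and alternatives $1,\dots,m$; a lottery is a point of the simplex $\Delta=\{x\in\mathbb{R}^m_{\ge 0}:\sum_j x_j=1\}$, with vertices $e_1,\dots,e_m$. Agent $i$ has unknown utilities $u_{i}\in\{0,\varepsilon,2\varepsilon,\dots,1\}^m$ and an unknown threshold $\tau_i\in\{\varepsilon,2\varepsilon,\dots,1\}$, and accepts exactly the lotteries in $\mathcal{A}_i=\{x\in\Delta:\langle u_i,x\rangle\ge\tau_i\}$. For $B\subseteq N$ let $P(B)=\bigcap_{i\in B}\mathcal{A}_i$ (so $P(\varnothing)=\Delta$) and, if $P(B)\neq\varnothing$, let $x_B$ be the lexicographically maximum point of $P(B)$. A lottery is unanimously acceptable if it lies in $P(N)$. An algorithm accesses the agents only through queries $\mathrm{Query}(i,x)$ ($i\in N$, $x\in\Delta$), which tell whether $x\in\mathcal{A}_i$; its cost is the number of queries. For a finite $C\subset\mathbb{R}^m$, $\mathrm{Select}(C)$ is the lexicographically maximum $x\in\Delta$ with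 $\langle c,x\rangle\ge 1$ for all $c\in C$, or $\textsc{Null}$ if there is none. **Learning one agent.** $\mathrm{ExactThreshold}(i,k,k')$: start with $[\ell,u]=[0,1]$; while $u-\ell\ge\varepsilon^2/2$, query agent $i$ at $(1-\alpha)e_k+\alpha e_{k'}$ with $\alpha=(\ell+u)/2$, and set $u\gets\alpha$ if it is accepted, $\ell\gets\alpha$ otherwise; then return the first of the fractions $\lceil q\ell\rceil/q$, $q=1,\dots,1/\varepsilon$, that is at most $u$. $\mathrm{LearnHyperplane}(i)$: query $e_1,\dots,e_m$, and let $L^{\rm acc}$, $L^{\rm rej}$ be the sets of accepted and rejected indices. If $L^{\rm rej}=\varnothing$ return $\textsc{AcceptAll}$; otherwise, if $L^{\rm acc}=\varnothing$ return $\textsc{RejectAll}$. Otherwise choose any $r\in L^{\rm rej}$ and compute $\alpha_{r,j}=\mathrm{ExactThreshold}(i,r,j)$ for $j\in L^{\rm acc}$. If all of them are $1$, return the indicator vector of $L^{\rm acc}$. Otherwise choose any $a\in L^{\rm acc}$ with $\alpha_{r,a}<1$, compute $\alpha_{k,a}=\mathrm{ExactThreshold}(i,k,a)$ for $k\in L^{\rm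 rej}\setminus\{r\}$, and return the vector $c$ with $c_r=0$, $c_j=1/\alpha_{r,j}$ for $j\in L^{\rm acc}$, and $c_k=(1-\alpha_{k,a}c_a)/(1-\alpha_{k,a})$ for $k\in L^{\rm rej}\setminus\{r\}$. **The algorithm with advice $\hat\sigma$.** Let $\hat\sigma$ be a permutation of $N$ and let $\mathrm{rank}_{\hat\sigma}(i)\in\{1,\dots,n\}$ be the position of $i$ in $\hat\sigma$. Initialize the weights $w_i=\lceil n/\mathrm{rank}_{\hat\sigma}(i)\rceil$. Repeat: let $W=\sum_i w_i$; draw uniformly at random, without replacement, $\min\{16(m-1)^2,W\}$ elements of the multiset that contains $w_i$ labeled copies of each agent $i$; run $\mathrm{LearnHyperplane}$ on every distinct sampled agent that has not been learned before, store the result, and return $\textsc{Null}$ if it is $\textsc{RejectAll}$; let $x=\mathrm{Select}(C)$, where $C$ is the set of stored vectors of the sampled agents, and return $\textsc{Null}$ if $x=\textsc{Null}$; query all $n$ agents at $x$, and return $x$ if all of them accept it; otherwise double the weight of each agent that rejects $x$. **Quality of the advice.** If $P(N)\ne\varnothing$, a witness set is a basis of $N$, i.e. an inclusion-minimal $B\subseteq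 N$ with $P(B)\neq\varnothing$ and $x_B=x_N$. If $P(N)=\varnothing$, a witness set is a set $B\subseteq N$ with $|B|\le m$ and $P(B)=\varnothing$. Let $E(\hat\sigma)$ be the least $k\ge 1$ such that the first $k$ agents of $\hat\sigma$ contain a witness set, and let $\mu=\log E(\hat\sigma)+\log\log n$ (natural logarithms). **Theorem.** There is an absolute constant $C>0$ such that for all $n,m,\varepsilon$ as above, every instance $(u_i,\tau_i)_{i\in N}$, every permutation $\hat\sigma$ of $N$ and every rule for the two choices in $\mathrm{LearnHyperplane}$ (a function that assigns to each nonempty set of indices one of its elements), the algorithm with advice $\hat\sigma$ terminates with probability $1$; whenever it terminates, its output is a unanimously acceptable lottery if one exists, and $\textsc{Null}$ otherwise; and if $\mu>0$ (which holds whenever $n\ge 3$), its expected number of queries is at most $$C\left(nm\mu+\min\{n,\,m^3\mu\}\cdot m\log(1/\varepsilon)\right).$$ -/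

import Mathlib

open scoped ENNReal

namespace Unanimity

/-! ### Lotteries, instances and acceptability -/

/-- Lotteries over `m` alternatives: the points of the standard simplex. -/
abbrev Lottery (m : ℕ) : Type := stdSimplex ℝ (Fin m)

/-- The pure lottery `e_j`. -/
noncomputable def pureLottery {m : ℕ} (j : Fin m) : Lottery m :=
  ⟨Pi.single j 1, single_mem_stdSimplex ℝ j⟩

/-- The edge lottery `(1 - α) e_k + α e_{k'}`. -/
noncomputable def edgeLottery {m : ℕ} (k k' : Fin m) (α : unitInterval) : Lottery m :=
  ⟨(1 - (α : ℝ)) • (pureLottery k : Fin m → ℝ) + (α : ℝ) • (pureLottery k' : Fin m → ℝ),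
    convex_stdSimplex ℝ (Fin m) (pureLottery k).2 (pureLottery k').2
      (sub_nonneg.2 α.2.2) α.2.1 (by ring)⟩

/-- An instance with `n` agents and `m` alternatives whose parameters are `ε`-quantized:
utilities lie in `{0, ε, 2ε, …, 1}` and thresholds in `{ε, 2ε, …, 1}`. -/
structure UtilityInstance (n m : ℕ) (ε : ℝ) where
  u : Fin n → Fin m → ℝ
  τ : Fin n → ℝ
  u_quantized : ∀ i j, ∃ k : ℕ, u i j = k * ε
  u_le_one : ∀ i j, u i j ≤ 1
  τ_quantized : ∀ i, ∃ k : ℕ, 1 ≤ k ∧ τ i = k * ε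
  τ_le_one : ∀ i, τ i ≤ 1

namespace UtilityInstance

variable {n m : ℕ} {ε : ℝ}

/-- The set `𝒜_i` of lotteries that agent `i` accepts. -/
def accepted (I : UtilityInstance n m ε) (i : Fin n) : Set (Lottery m) :=
  {x | I.τ i ≤ ∑ j, I.u i j * (x : Fin m → ℝ) j}

/-- `P(B)`, the lotteries that all agents of `B` accept. -/
def feasible (I : UtilityInstance n m ε) (B : Finset (Fin n)) : Set (Lottery m) :=
  {x | ∀ i ∈ B, x ∈ I.accepted i}

/-- A lottery is unanimously acceptable if every agent accepts it. -/
def Unanimous (I : UtilityInstance n m ε) (x : Lottery m) : Prop :=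
  ∀ i, x ∈ I.accepted i

open Classical in
/-- The membership oracle `Query(i, x)`. -/
noncomputable def oracle (I : UtilityInstance n m ε) (i : Fin n) (x : Lottery m) : Bool :=
  decide (x ∈ I.accepted i)

/-- What the problem asks of an output (`none` stands for `Null`): a unanimously acceptable
lottery if there is one, and `Null` otherwise. -/
def CorrectOutput (I : UtilityInstance n m ε) (o : Option (Lottery m)) : Prop :=
  ((∃ x, I.Unanimous x) → ∃ x, o = some x ∧ I.Unanimous x) ∧
    ((¬ ∃ x, I.Unanimous x) → o = none)

end UtilityInstance

/-! ### Lexicographic selection -/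

/-- `x` is the lexicographically maximum point of `F`. -/
def IsLexMax {m : ℕ} (F : Set (Lottery m)) (x : Lottery m) : Prop :=
  x ∈ F ∧ ∀ y ∈ F, toLex (y : Fin m → ℝ) ≤ toLex (x : Fin m → ℝ)

open Classical in
/-- The lexicographically maximum point of `F`, or `none` if there is none. It is only applied
to closed sets of lotteries, where `none` means that `F` is empty. -/
noncomputable def lexMax {m : ℕ} (F : Set (Lottery m)) : Option (Lottery m) :=
  if h : ∃ x, IsLexMax F x then some h.choose else none

/-- `Select(C)`: the lexicographically maximum lottery `x` with `⟨c, x⟩ ≥ 1` for all `c ∈ C`,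
or `none` (`Null`) if there is no such lottery. -/
noncomputable def select {m : ℕ} (C : Set (Fin m → ℝ)) : Option (Lottery m) :=
  lexMax {x | ∀ c ∈ C, 1 ≤ ∑ j, c j * (x : Fin m → ℝ) j}

/-! ### Computations with a membership oracle -/

/-- A finite adaptive computation (a decision tree) whose only access to the agents is through
membership queries `Query(i, x)`. -/
inductive QueryComp (n m : ℕ) (α : Type) : Type
  | ret (a : α) : QueryComp n m α
  | query (i : Fin n) (x : Lottery m) (next : Bool → QueryComp n m α) : QueryComp n m α

namespace QueryComp

variable {n m : ℕ} {α β : Type}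

/-- Sequential composition. -/
def andThen : QueryComp n m α → (α → QueryComp n m β) → QueryComp n m β
  | ret a, f => f a
  | query i x next, f => query i x (fun b => andThen (next b) f)

instance : Monad (QueryComp n m) where
  pure := ret
  bind := andThen

/-- A single membership query. -/
def ask (i : Fin n) (x : Lottery m) : QueryComp n m Bool :=
  query i x ret

/-- The result of the computation against the oracle `O`, with the number of queries made. -/
def run (O : Fin n → Lottery m → Bool) : QueryComp n m α → α × ℕ
  | ret a => (a, 0)
  | query i x next => ((run O (next (O i x))).1, (run O (next (O i x))).2 + 1)

/-- Run `f j` for every `j` in the list, in this order, and return the table of the results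
(with the value `d` outside the list). -/
def table {ι : Type} [DecidableEq ι] (f : ι → QueryComp n m β) (d : β) :
    List ι → QueryComp n m (ι → β)
  | [] => pure (fun _ => d)
  | j :: l => do
    let b ← f j
    let g ← table f d l
    pure (Function.update g j b)

end QueryComp

/-! ### Learning the halfspace of one agent -/

/-- The midpoint of two points of `[0,1]`. -/
noncomputable def mid (l u : unitInterval) : unitInterval :=
  ⟨((l : ℝ) + u) / 2, by
    have h1 := l.2.1; have h2 := l.2.2; have h3 := u.2.1; have h4 := u.2.2
    constructor <;> linarith⟩

theorem floor_half_lt {a d : ℝ} (hd : 0 < d) (h : d ≤ a) : ⌊a / 2 / d⌋₊ < ⌊a / d⌋₊ := by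
  have h1 : 1 ≤ a / d := by rwa [le_div_iff₀ hd, one_mul]
  have h2 : a / 2 / d = a / d / 2 := by ring
  have h3 : 1 ≤ ⌊a / d⌋₊ := Nat.le_floor (by simpa using h1)
  rw [h2, Nat.floor_div_ofNat]
  exact Nat.div_lt_self h3 one_lt_two

open Classical in
/-- The bisection phase of `ExactThreshold(i, k, k')`: while `u - l ≥ ε² / 2`, query the midpoint
and halve the bracket `[l, u]`. (The test `0 < ε` always succeeds for the values of `ε` at hand.) -/
noncomputable def bisect {n m : ℕ} (ε : ℝ) (i : Fin n) (k k' : Fin m) (l u : unitInterval) :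
    QueryComp n m (unitInterval × unitInterval) :=
  if _h : 0 < ε ∧ ε ^ 2 / 2 ≤ (u : ℝ) - l then
    QueryComp.query i (edgeLottery k k' (mid l u)) fun b =>
      if b = true then bisect ε i k k' l (mid l u) else bisect ε i k k' (mid l u) u
  else QueryComp.ret (l, u)
termination_by ⌊((u : ℝ) - l) / (ε ^ 2 / 2)⌋₊
decreasing_by
  all_goals
    have hd : 0 < ε ^ 2 / 2 := by have := _h.1; positivity
    have key := floor_half_lt hd _h.2
  · have e : ((mid l u : unitInterval) : ℝ) - l = ((u : ℝ) - l) / 2 := by simp only [mid]; ring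
    rwa [e]
  · have e : (u : ℝ) - (mid l u : unitInterval) = ((u : ℝ) - l) / 2 := by simp only [mid]; ring
    rwa [e]

open Classical in
/-- Rational reconstruction: the first of the fractions `⌈q l⌉ / q`, `q = 1, …, Q`, that is at
most `u` (the value `u` when there is none is never used). -/
noncomputable def reconstruct (Q : ℕ) (l u : ℝ) : ℝ :=
  match (List.range' 1 Q).find? (fun q : ℕ => decide ((⌈(q : ℝ) * l⌉ : ℝ) / q ≤ u)) with
  | some q => (⌈(q : ℝ) * l⌉ : ℝ) / q
  | none => u

/-- `ExactThreshold(i, k, k')`: the turning point of agent `i` on the edge from the rejected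
pure lottery `e_k` to the accepted one `e_{k'}`. Here `1 / ε` is an integer. -/
noncomputable def exactThreshold {n m : ℕ} (ε : ℝ) (i : Fin n) (k k' : Fin m) :
    QueryComp n m ℝ := do
  let b ← bisect ε i k k' 0 1
  pure (reconstruct ⌊1 / ε⌋₊ b.1 b.2)

/-- The possible results of `LearnHyperplane`. -/
inductive Learned (m : ℕ) : Type
  | acceptAll : Learned m
  | rejectAll : Learned m
  | halfspace (c : Fin m → ℝ) : Learned m

open Classical in
/-- `LearnHyperplane(i)`. The function `pick` resolves the two instructions "choose any element
of the (nonempty) set". -/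
noncomputable def learnHyperplane {n m : ℕ} (ε : ℝ) (pick : Finset (Fin m) → Fin m)
    (i : Fin n) : QueryComp n m (Learned m) := do
  let acc ← QueryComp.table (fun j => QueryComp.ask i (pureLottery j)) false (List.finRange m)
  let Lacc : Finset (Fin m) := Finset.univ.filter (fun j => acc j = true)
  let Lrej : Finset (Fin m) := Finset.univ.filter (fun j => acc j = false)
  if Lrej = ∅ then
    pure Learned.acceptAll
  else if Lacc = ∅ then
    pure Learned.rejectAll
  else
    let r := pick Lrej
    let α ← QueryComp.table (fun j => exactThreshold ε i r j) 0
      ((List.finRange m).filter (fun j => decide (j ∈ Lacc)))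
    if ∀ j ∈ Lacc, α j = 1 then
      pure (Learned.halfspace (fun j => if j ∈ Lacc then 1 else 0))
    else
      let a := pick (Lacc.filter (fun j => α j < 1))
      let α' ← QueryComp.table (fun k => exactThreshold ε i k a) 0
        ((List.finRange m).filter (fun k => decide (k ∈ Lrej.erase r)))
      pure (Learned.halfspace (fun j =>
        if j = r then 0
        else if j ∈ Lacc then 1 / α j
        else (1 - α' j * (1 / α a)) / (1 - α' j)))

/-! ### The randomized algorithm -/

/-- The variables of the algorithm: the integer weights, the flags telling which agents have been
learned, and the learned constraints (`none` for an agent that is not learned or accepts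
everything). -/
structure AlgState (n m : ℕ) : Type where
  w : Fin n → ℕ
  known : Fin n → Bool
  c : Fin n → Option (Fin m → ℝ)

/-- `WeightedSample(w, min{r, W})` with `W = ∑ w_i`: a uniformly random subset of this size,
without replacement, of the multiset that contains `w_i` labeled copies of each agent `i`. -/
noncomputable def weightedSample {n : ℕ} (w : Fin n → ℕ) (r : ℕ) :
    PMF (Finset (Σ i : Fin n, Fin (w i))) :=
  PMF.uniformOfFinset
    (Finset.powersetCard (min r (∑ i, w i)) (Finset.univ : Finset (Σ i : Fin n, Fin (w i))))
    (Finset.powersetCard_nonempty.2 (by simp [Fintype.card_sigma]))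

/-- Learn the agents of the list that are not known yet; `none` as soon as one of them is found
to reject every lottery. -/
noncomputable def learnSample {n m : ℕ} (ε : ℝ) (pick : Finset (Fin m) → Fin m) :
    List (Fin n) → AlgState n m → QueryComp n m (Option (AlgState n m))
  | [], s => pure (some s)
  | i :: l, s =>
    if s.known i = true then learnSample ε pick l s
    else do
      match ← learnHyperplane ε pick i with
      | Learned.rejectAll => pure none
      | Learned.acceptAll =>
        learnSample ε pick l
          { s with known := Function.update s.known i true, c := Function.update s.c i none }
      | Learned.halfspace c =>
        learnSample ε pick l
          { s with known := Function.update s.known i true, c := Function.update s.c i (some c) }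

open Classical in
/-- One pass through the loop, once the set `N'` of distinct sampled agents is known. It either
returns an output (left) or the variables at the start of the next pass (right), in which the
weights of all violators have been doubled. -/
noncomputable def loopBody {n m : ℕ} (ε : ℝ) (pick : Finset (Fin m) → Fin m)
    (N' : Finset (Fin n)) (s : AlgState n m) :
    QueryComp n m (Option (Lottery m) ⊕ AlgState n m) := do
  match ← learnSample ε pick ((List.finRange n).filter (fun i => decide (i ∈ N'))) s with
  | none => pure (Sum.inl none)
  | some s' =>
    match select {c | ∃ i ∈ N', s'.c i = some c} with
    | none => pure (Sum.inl none)
    | some x => do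
      let ans ← QueryComp.table (fun i => QueryComp.ask i x) true (List.finRange n)
      if ∀ i, ans i = true then pure (Sum.inl (some x))
      else pure (Sum.inr { s' with w := fun i => if ans i = true then s'.w i else 2 * s'.w i })

/-- One iteration against the oracle `O`: the joint law of its result and of the number of
queries it makes. The sample size is `min{r, W}` with `r = 16 (m - 1)²`. -/
noncomputable def iteration {n m : ℕ} (ε : ℝ) (pick : Finset (Fin m) → Fin m)
    (O : Fin n → Lottery m → Bool) (s : AlgState n m) :
    PMF ((Option (Lottery m) ⊕ AlgState n m) × ℕ) :=
  (weightedSample s.w (16 * (m - 1) ^ 2)).map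
    (fun R => (loopBody ε pick (R.image Sigma.fst) s).run O)

/-- At most `t` iterations: the joint law of the result (an output, or the current variables if
the algorithm has not returned yet) and of the number of queries made so far. -/
noncomputable def runFor {n m : ℕ} (ε : ℝ) (pick : Finset (Fin m) → Fin m)
    (O : Fin n → Lottery m → Bool) :
    ℕ → AlgState n m → PMF ((Option (Lottery m) ⊕ AlgState n m) × ℕ)
  | 0, s => PMF.pure (Sum.inr s, 0)
  | t + 1, s => (iteration ε pick O s).bind (fun z =>
      match z with
      | (Sum.inl o, q) => PMF.pure (Sum.inl o, q)
      | (Sum.inr s', q) => (runFor ε pick O t s').map (fun z' => (z'.1, q + z'.2)))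

/-- The position `rank_σ(i) ∈ {1, …, n}` of agent `i` in the order `σ(1), …, σ(n)`. -/
def rank {n : ℕ} (σ : Equiv.Perm (Fin n)) (i : Fin n) : ℕ := (σ.symm i : ℕ) + 1

/-- The initial variables with advice `σ`: weights `⌈n / rank_σ(i)⌉`, and nothing is known. -/
noncomputable def initState {n : ℕ} (m : ℕ) (σ : Equiv.Perm (Fin n)) : AlgState n m where
  w := fun i => ⌈(n : ℝ) / (rank σ i : ℝ)⌉₊
  known := fun _ => false
  c := fun _ => none

/-- The law of the pair (output, total number of queries) of the randomized algorithm with advice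
`σ` on the instance `I`: the mass at `(o, q)` is the probability that the algorithm terminates
with output `o` after exactly `q` queries. -/
noncomputable def outcomeLaw {n m : ℕ} {ε : ℝ} (I : UtilityInstance n m ε)
    (pick : Finset (Fin m) → Fin m) (σ : Equiv.Perm (Fin n)) (z : Option (Lottery m) × ℕ) :
    ℝ≥0∞ :=
  ⨆ t : ℕ, runFor ε pick I.oracle t (initState m σ) (Sum.inl z.1, z.2)

/-! ### Witness sets and the quality of the advice -/

namespace UtilityInstance

variable {n m : ℕ} {ε : ℝ}

/-- `B` is a basis of `N'`: a minimal subset of `N'` with `P(B) ≠ ∅` and `x_B = x_{N'}`, where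
`x_B` denotes the lexicographically maximum point of `P(B)`. -/
def IsBasis (I : UtilityInstance n m ε) (N' B : Finset (Fin n)) : Prop :=
  Minimal (fun B' => B' ⊆ N' ∧ (I.feasible B').Nonempty ∧
    lexMax (I.feasible B') = lexMax (I.feasible N')) B

/-- The witness sets: the bases of the set of all agents if the instance is feasible, and the
sets of at most `m` agents with no commonly accepted lottery if it is not. -/
def IsWitnessSet (I : UtilityInstance n m ε) (B : Finset (Fin n)) : Prop :=
  ((I.feasible Finset.univ).Nonempty ∧ I.IsBasis Finset.univ B) ∨
    (I.feasible Finset.univ = ∅ ∧ B.card ≤ m ∧ I.feasible B = ∅)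

/-- `E(σ)`: the least `k ≥ 1` such that the first `k` agents of `σ` contain a witness set. -/
noncomputable def prefixWitness (I : UtilityInstance n m ε) (σ : Equiv.Perm (Fin n)) : ℕ :=
  sInf {k | 1 ≤ k ∧ ∃ B, I.IsWitnessSet B ∧ ∀ i ∈ B, rank σ i ≤ k}

/-- `μ = log E(σ) + log log n`. -/
noncomputable def adviceMu (I : UtilityInstance n m ε) (σ : Equiv.Perm (Fin n)) : ℝ :=
  Real.log (I.prefixWitness σ) + Real.log (Real.log n)

end UtilityInstance

end Unanimity

open scoped ENNReal

namespace Unanimity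

/-! ### Lexicographic maxima -/

section Lex

variable {m : ℕ}

/-! The algorithm is iterative reweighting in the style of Clarkson for an LP-type problem of
combinatorial dimension at most `m`. Strict upper sets of the lexicographic order are convex and the
simplex has dimension `m - 1`, so Helly's theorem shows that at most `m` agents of any set are
extreme, i.e. reject the optimum of the others (`exists_certificate`, `card_extreme_le`). Double
counting turns this into a sampling bound: the violators of a sample carry on average at most a
`1/(4m)` fraction of the weight (`sum_violatedWeight_le`), so the total weight grows by a factor of
at most `1 + 1/(4m)` per pass in expectation. On the other hand, an optimum accepted by a witness
set is accepted by everybody (`IsWitnessSet.unanimous`). Every failed pass therefore doubles some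
weight in a fixed set `B` of at most `m` agents, and the geometric mean of the weights in `B` grows
by at least `exp(1/(2m))`.

Good advice gives this race a head start: each member of `B` begins with weight at least `n/E`,
while the total is at most `n (log n + 2)`. Comparing the two growth rates, `t` passes all fail with
probability at most `E (log n + 2) exp(-t/(4m))` (`aliveProb_potential`, `aliveProb_initState_le`).
This tends to `0`, hence termination; summed over `t` it gives `O(m μ)` expected passes
(`sum_aliveProb_le`).

A pass spends `n` queries on verification. Learning an agent is exact, because turning points are
fractions with denominators at most `1/ε` (`reconstruct_eq`), and takes `O(m log(1/ε))` queries
(`learnHyperplane_spec`). Learning is charged either once per agent over the whole run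
(`expect_queries_le`) or to the sample size in each pass (`expect_queries_le'`); the two charges
give the minimum in the bound. Correctness of the output holds on every run (`loopBody_spec`). -/

theorem isLexMax_unique {F : Set (Lottery m)} {x y : Lottery m} (hx : IsLexMax F x)
    (hy : IsLexMax F y) : x = y :=
  Subtype.ext (toLex.injective (le_antisymm (hy.2 x hx.1) (hx.2 y hy.1)))

theorem lexMax_eq_some {F : Set (Lottery m)} {x : Lottery m} :
    lexMax F = some x ↔ IsLexMax F x := by
  unfold lexMax
  constructor
  · intro h
    split_ifs at h with hF
    rw [← Option.some.inj h]
    exact hF.choose_spec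
  · intro h
    have hF : ∃ x, IsLexMax F x := ⟨x, h⟩
    rw [dif_pos hF, isLexMax_unique hF.choose_spec h]

/-- Maximizing the first `k` coordinates one after the other over a compact set. -/
theorem exists_compact_lex_prefix {K : Set (Fin m → ℝ)} (hK : IsCompact K) (hne : K.Nonempty)
    (k : ℕ) (hk : k ≤ m) :
    ∃ K' ⊆ K, IsCompact K' ∧ K'.Nonempty ∧ ∀ x ∈ K', ∀ y ∈ K,
      (∃ i : Fin m, (∀ j < i, y j = x j) ∧ y i < x i) ∨
        (y ∈ K' ∧ ∀ i : Fin m, (i : ℕ) < k → y i = x i) := by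
  induction k with
  | zero => exact ⟨K, subset_rfl, hK, hne, fun x _ y hy => Or.inr ⟨hy, by simp⟩⟩
  | succ k ih =>
    obtain ⟨K', hsub, hK', hne', h⟩ := ih (by omega)
    set p : Fin m := ⟨k, hk⟩
    obtain ⟨z, hz, hzmax⟩ := hK'.exists_isMaxOn hne' (continuous_apply p).continuousOn
    -- Among the maximizers of the first `k` coordinates, keep those with the largest coordinate
    -- `p`; any other point of `K'` loses at `p`.
    refine ⟨K' ∩ {x | x p = z p}, fun x hx => hsub hx.1,
      hK'.inter_right (isClosed_eq (continuous_apply p) continuous_const), ⟨z, hz, rfl⟩, ?_⟩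
    rintro x ⟨hx, hxp⟩ y hy
    rcases h x hx y hy with hlt | ⟨hyK, heq⟩
    · exact Or.inl hlt
    · have hle : y p ≤ z p := hzmax hyK
      rcases hle.lt_or_eq with hlt | he
      · exact Or.inl ⟨p, fun j hj => heq j hj, hlt.trans_eq hxp.symm⟩
      · refine Or.inr ⟨⟨hyK, he⟩, fun i hi => ?_⟩
        rcases Nat.lt_succ_iff_lt_or_eq.1 hi with h1 | h1
        · exact heq i h1
        · have : i = p := Fin.ext h1
          rw [this, he, hxp]

theorem exists_isLexMax {F : Set (Lottery m)} (hF : IsClosed F) (hne : F.Nonempty) :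
    ∃ x, IsLexMax F x := by
  have hc : IsCompact (Subtype.val '' F : Set (Fin m → ℝ)) :=
    haveI := isCompact_iff_compactSpace.1 (isCompact_stdSimplex (𝕜 := ℝ) (Fin m))
    hF.isCompact.image continuous_subtype_val
  obtain ⟨K', hsub, -, ⟨x, hx⟩, h⟩ := exists_compact_lex_prefix hc (hne.image _) m le_rfl
  obtain ⟨x, hxF, rfl⟩ := hsub hx
  refine ⟨x, hxF, fun y hy => ?_⟩
  rcases h _ hx _ ⟨y, hy, rfl⟩ with ⟨i, hj, hlt⟩ | ⟨-, heq⟩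
  · exact le_of_lt ⟨i, hj, hlt⟩
  · exact le_of_eq (congrArg toLex (funext fun i => heq i i.2))

/-- Before the first coordinate where `p` and `q` differ nothing changes, and there any positive
weight on `q` raises the value. -/
theorem toLex_le_combination {p q : Fin m → ℝ} (h : toLex p ≤ toLex q) {a b : ℝ} (hb : 0 ≤ b)
    (hab : a + b = 1) : toLex p ≤ toLex (a • p + b • q) := by
  have ha : a = 1 - b := by linarith
  subst ha
  rcases h.lt_or_eq with ⟨i, hj, hlt⟩ | he
  · rcases hb.eq_or_lt with rfl | hb
    · simp
    · refine le_of_lt ⟨i, fun j hji => ?_, ?_⟩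
      · have : p j = q j := hj j hji
        simp only [Pi.toLex_apply, Pi.add_apply, Pi.smul_apply, smul_eq_mul, this]
        ring
      · have : p i < q i := hlt
        simp only [Pi.toLex_apply, Pi.add_apply, Pi.smul_apply, smul_eq_mul]
        nlinarith
  · rw [toLex.injective he, ← add_smul, hab, one_smul]

/-- This lets the lexicographic objective enter Helly's theorem as one more convex set. -/
theorem convex_lex_above (y : Fin m → ℝ) : Convex ℝ {x : Fin m → ℝ | toLex y < toLex x} := by
  intro p hp q hq a b ha hb hab
  rcases le_total (toLex p) (toLex q) with h | h
  · exact lt_of_lt_of_le hp (toLex_le_combination h hb hab)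
  · have := toLex_le_combination h ha (by rwa [add_comm] at hab)
    rw [add_comm] at this
    exact lt_of_lt_of_le hq this

end Lex

/-! ### Helly's theorem for lotteries -/

section Helly

variable {m : ℕ}

/-- Helly's theorem in the simplex: convex sets of lotteries over `m` alternatives have a common
point as soon as any `m` of them do. -/
theorem helly_lottery {ι : Type*} (hm : 1 ≤ m) {F : ι → Set (Lottery m)} {s : Finset ι}
    (hF : ∀ i ∈ s, Convex ℝ (Subtype.val '' F i))
    (h : ∀ t ⊆ s, t.card ≤ m → ∃ x, ∀ i ∈ t, x ∈ F i) : ∃ x, ∀ i ∈ s, x ∈ F i := by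
  obtain ⟨k, rfl⟩ : ∃ k, m = k + 1 := ⟨m - 1, by omega⟩
  rcases s.eq_empty_or_nonempty with rfl | ⟨i₀, hi₀⟩
  · exact h ∅ subset_rfl (by simp)
  -- On the simplex, coordinate `0` is determined by the others. Forgetting it lowers the dimension
  -- to `m - 1`, so the Helly number is `m` rather than `m + 1`.
  set π : (Fin (k + 1) → ℝ) →ₗ[ℝ] (Fin k → ℝ) := LinearMap.funLeft ℝ ℝ Fin.succ with hπ
  have hinj : ∀ x y : Lottery (k + 1), π x = π y → x = y := by
    intro x y hxy
    have h1 : ∀ j : Fin k, x.1 j.succ = y.1 j.succ :=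
      fun j => congrFun hxy j
    have hx := x.2.2
    have hy := y.2.2
    rw [Fin.sum_univ_succ] at hx hy
    apply Subtype.ext
    funext j
    refine Fin.cases ?_ h1 j
    rw [Finset.sum_congr rfl fun j _ => h1 j] at hx
    linarith
  have key := Convex.helly_theorem' (𝕜 := ℝ) (F := fun i => π '' (Subtype.val '' F i)) (s := s)
    (fun i hi => (hF i hi).linear_image π) (fun t ht htc => by
      rw [Module.finrank_fin_fun] at htc
      obtain ⟨x, hx⟩ := h t ht htc
      exact ⟨π x, Set.mem_iInter₂.2 fun i hi => ⟨x, ⟨x, hx i hi, rfl⟩, rfl⟩⟩)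
  obtain ⟨z, hz⟩ := key
  rw [Set.mem_iInter₂] at hz
  obtain ⟨-, ⟨x, hx, rfl⟩, rfl⟩ := hz i₀ hi₀
  refine ⟨x, fun i hi => ?_⟩
  obtain ⟨-, ⟨y, hy, rfl⟩, hxy⟩ := hz i hi
  rwa [← hinj y x hxy]

end Helly

/-! ### Certificates, bases and witness sets -/

namespace UtilityInstance

variable {n m : ℕ} {ε : ℝ} (I : UtilityInstance n m ε)

theorem isClosed_accepted (i : Fin n) : IsClosed (I.accepted i) := by
  unfold accepted
  exact isClosed_le continuous_const (continuous_finsetSum _ fun j _ =>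
    continuous_const.mul ((continuous_apply j).comp continuous_subtype_val))

theorem isClosed_feasible (B : Finset (Fin n)) : IsClosed (I.feasible B) := by
  have : I.feasible B = ⋂ i ∈ B, I.accepted i := by ext; simp [feasible]
  rw [this]
  exact isClosed_biInter fun i _ => I.isClosed_accepted i

theorem feasible_anti {B B' : Finset (Fin n)} (h : B ⊆ B') : I.feasible B' ⊆ I.feasible B :=
  fun _ hx i hi => hx i (h hi)

theorem exists_isLexMax_feasible {B : Finset (Fin n)} (h : (I.feasible B).Nonempty) :
    ∃ x, IsLexMax (I.feasible B) x :=
  exists_isLexMax (I.isClosed_feasible B) h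

theorem convex_image_accepted (i : Fin n) :
    Convex ℝ (Subtype.val '' I.accepted i : Set (Fin m → ℝ)) := by
  have : (Subtype.val '' I.accepted i : Set (Fin m → ℝ)) =
      stdSimplex ℝ (Fin m) ∩ {x | I.τ i ≤ ∑ j, I.u i j * x j} := by
    ext x
    constructor
    · rintro ⟨x, hx, rfl⟩
      exact ⟨x.2, hx⟩
    · rintro ⟨hx, h⟩
      exact ⟨⟨x, hx⟩, h, rfl⟩
  rw [this]
  refine (convex_stdSimplex ℝ _).inter (convex_halfSpace_ge ⟨fun x y => ?_, fun c x => ?_⟩ _)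
  · simp [mul_add, Finset.sum_add_distrib]
  · simp only [Pi.smul_apply, smul_eq_mul, Finset.mul_sum]
    exact Finset.sum_congr rfl fun j _ => by ring

/-- A bounded subset of `S` certifies that no lottery feasible for it lies lexicographically above
`P(S)`. -/
theorem exists_certificate (hm : 1 ≤ m) (S : Finset (Fin n)) :
    ∃ T ⊆ S, T.card ≤ m ∧ ¬ ∃ x ∈ I.feasible T, ∀ y ∈ I.feasible S,
      toLex (y : Fin m → ℝ) < toLex (x : Fin m → ℝ) := by
  by_contra! hcon
  -- `K` (indexed by `none`) and the acceptance sets of `S` have no common point, so Helly's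
  -- condition must fail for some small subfamily. If `P(S)` is empty, `K` is the whole simplex and
  -- the certificate is an infeasible subset.
  set K : Set (Lottery m) := {x | ∀ y ∈ I.feasible S, toLex (y : Fin m → ℝ) < toLex (x : Fin m → ℝ)}
  set F : Option (Fin n) → Set (Lottery m) := fun o => o.elim K I.accepted
  have hK : Convex ℝ (Subtype.val '' K : Set (Fin m → ℝ)) := by
    have : (Subtype.val '' K : Set (Fin m → ℝ)) =
        stdSimplex ℝ (Fin m) ∩ ⋂ y ∈ I.feasible S, {x | toLex (y : Fin m → ℝ) < toLex x} := by
      ext x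
      constructor
      · rintro ⟨x, hx, rfl⟩
        exact ⟨x.2, Set.mem_iInter₂.2 hx⟩
      · rintro ⟨hx, h⟩
        exact ⟨⟨x, hx⟩, Set.mem_iInter₂.1 h, rfl⟩
    rw [this]
    exact (convex_stdSimplex ℝ _).inter (convex_iInter₂ fun y _ => convex_lex_above _)
  obtain ⟨x, hx⟩ := helly_lottery hm (F := F) (s := Finset.insertNone S) (by
    rintro (_ | i) -
    · exact hK
    · exact I.convex_image_accepted i) (by
    intro t ht htc
    obtain ⟨x, hx, hxK⟩ := hcon t.eraseNone (by
        intro i hi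
        simpa using ht (Finset.mem_eraseNone.1 hi))
      ((Finset.card_eraseNone_le t).trans htc)
    refine ⟨x, ?_⟩
    rintro (_ | i) hi
    · exact hxK
    · exact hx i (Finset.mem_eraseNone.2 hi))
  have hxS : x ∈ I.feasible S := fun i hi => hx (some i) (by simpa using hi)
  exact lt_irrefl _ (hx none (by simp) x hxS)

/-- At most `m` agents of `S` reject the lexicographic optimum of the others. -/
theorem card_extreme_le (hm : 1 ≤ m) (S E : Finset (Fin n)) (hE : E ⊆ S)
    (h : ∀ i ∈ E, ∃ x, IsLexMax (I.feasible (S.erase i)) x ∧ x ∉ I.accepted i) : E.card ≤ m := by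
  obtain ⟨T, hTS, hTm, hT⟩ := I.exists_certificate hm S
  refine (Finset.card_le_card fun i hi => ?_).trans hTm
  by_contra hiT
  obtain ⟨x, hx, hxi⟩ := h i hi
  -- If `i` were outside `T`, the optimum `x` of `S.erase i` would lie in `P(T)` and above all of
  -- `P(S)`, strictly because `i` rejects `x`.
  refine hT ⟨x, fun k hk => hx.1 k (Finset.mem_erase.2 ⟨?_, hTS hk⟩), fun y hy => ?_⟩
  · rintro rfl
    exact hiT hk
  · refine lt_of_le_of_ne (hx.2 y (I.feasible_anti (Finset.erase_subset _ _) hy)) fun he => hxi ?_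
    rw [← Subtype.ext (toLex.injective he)]
    exact hy i (hE hi)

/-- Minimality makes every member of `B` extreme in `B`: if `i` accepted the optimum of the others,
`B.erase i` would have the same optimum. -/
theorem IsBasis.card_le {I : UtilityInstance n m ε} (hm : 1 ≤ m) {N' B : Finset (Fin n)}
    (hB : I.IsBasis N' B) : B.card ≤ m := by
  refine I.card_extreme_le hm B B subset_rfl fun i hi => ?_
  obtain ⟨hBN, hne, hlex⟩ := hB.1
  have hne' : (I.feasible (B.erase i)).Nonempty := hne.mono (I.feasible_anti (Finset.erase_subset _ _))
  obtain ⟨x, hx⟩ := I.exists_isLexMax_feasible hne'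
  refine ⟨x, hx, fun hxi => ?_⟩
  have hxB : IsLexMax (I.feasible B) x := by
    refine ⟨fun k hk => ?_, fun y hy => hx.2 y (I.feasible_anti (Finset.erase_subset _ _) hy)⟩
    by_cases hki : k = i
    · exact hki ▸ hxi
    · exact hx.1 k (Finset.mem_erase.2 ⟨hki, hk⟩)
  have := hB.2 (y := B.erase i) ⟨(Finset.erase_subset _ _).trans hBN, hne', by
    rw [← hlex, lexMax_eq_some.2 hx, lexMax_eq_some.2 hxB]⟩ (Finset.erase_subset _ _)
  exact Finset.notMem_erase i B (this hi)

theorem IsWitnessSet.card_le {I : UtilityInstance n m ε} (hm : 1 ≤ m) {B : Finset (Fin n)}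
    (hB : I.IsWitnessSet B) : B.card ≤ m := by
  rcases hB with ⟨-, h⟩ | ⟨-, h, -⟩
  · exact h.card_le hm
  · exact h

/-- Ensures that the infimum defining `E(σ)` is attained. In the infeasible case every lottery is
vacuously above `P(N)`, so the certificate itself is a witness set. -/
theorem exists_isWitnessSet (hm : 1 ≤ m) : ∃ B, I.IsWitnessSet B := by
  rcases (I.feasible Finset.univ).eq_empty_or_nonempty with he | hne
  · obtain ⟨T, -, hTm, hT⟩ := I.exists_certificate hm Finset.univ
    refine ⟨T, Or.inr ⟨he, hTm, Set.eq_empty_iff_forall_notMem.2 fun x hx => hT ⟨x, hx, ?_⟩⟩⟩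
    simp [he]
  · obtain ⟨B, -, hB⟩ := (Set.toFinite {B' : Finset (Fin n) | B' ⊆ Finset.univ ∧
      (I.feasible B').Nonempty ∧ lexMax (I.feasible B') = lexMax (I.feasible Finset.univ)}
      ).exists_le_minimal (a := Finset.univ) ⟨subset_rfl, hne, rfl⟩
    exact ⟨B, Or.inl ⟨hne, hB⟩⟩

/-- A lexicographic optimum that is accepted by a witness set is accepted by all agents. -/
theorem IsWitnessSet.unanimous {I : UtilityInstance n m ε} {B N' : Finset (Fin n)}
    (hB : I.IsWitnessSet B) {x : Lottery m} (hx : IsLexMax (I.feasible N') x)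
    (hxB : x ∈ I.feasible B) : I.Unanimous x := by
  rcases hB with ⟨hne, hB⟩ | ⟨-, -, he⟩
  · obtain ⟨-, -, hlex⟩ := hB.1
    obtain ⟨z, hz⟩ := I.exists_isLexMax_feasible hne
    have hzB : IsLexMax (I.feasible B) z := lexMax_eq_some.1 (hlex.trans (lexMax_eq_some.2 hz))
    -- `z` competes in `P(N')`, so `z ≤ x`; and `x` competes in `P(B)`, whose optimum is `z`, so `x
    -- ≤ z`.
    have hzx : z = x := Subtype.ext (toLex.injective (le_antisymm
      (hx.2 z (I.feasible_anti (Finset.subset_univ _) hz.1)) (hzB.2 x hxB)))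
    exact fun i => hzx ▸ hz.1 i (Finset.mem_univ i)
  · exact absurd hxB (he ▸ Set.notMem_empty x)

end UtilityInstance

/-! ### Running query computations -/

namespace QueryComp

variable {n m : ℕ} {α β : Type} (O : Fin n → Lottery m → Bool)

theorem run_pure (a : α) : (pure a : QueryComp n m α).run O = (a, 0) := rfl

theorem run_bind (c : QueryComp n m α) (f : α → QueryComp n m β) :
    (c >>= f).run O =
      (((f (c.run O).1).run O).1, (c.run O).2 + ((f (c.run O).1).run O).2) := by
  change (andThen c f).run O = _
  induction c with
  | ret a => simp [andThen, run]
  | query i x next ih =>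
    simp only [andThen, run, ih]
    ext1
    · rfl
    · simp only; omega

theorem run_ask (i : Fin n) (x : Lottery m) :
    (ask i x : QueryComp n m Bool).run O = (O i x, 1) := rfl

theorem run_table {ι : Type} [DecidableEq ι] (f : ι → QueryComp n m β) (d : β) (l : List ι) :
    (table f d l).run O =
      (fun j => if j ∈ l then ((f j).run O).1 else d, (l.map fun j => ((f j).run O).2).sum) := by
  induction l with
  | nil => simp [table, run_pure]
  | cons a l ih =>
    simp only [table, run_bind, ih, run_pure, List.map_cons, List.sum_cons, add_zero,
      Prod.mk.injEq, and_true]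
    funext j
    by_cases h : j = a
    · subst h; simp
    · simp [h]

end QueryComp

/-! ### Bisection and rational reconstruction -/

theorem coe_mid (l u : unitInterval) : (mid l u : ℝ) = ((l : ℝ) + u) / 2 := rfl

theorem sum_mul_pureLottery {m : ℕ} (v : Fin m → ℝ) (j : Fin m) :
    ∑ k, v k * pureLottery j k = v j := by
  change ∑ k, v k * (Pi.single j 1 : Fin m → ℝ) k = v j
  simp [Pi.single_apply]

theorem sum_mul_edgeLottery {m : ℕ} (v : Fin m → ℝ) (k k' : Fin m) (α : unitInterval) :
    ∑ j, v j * edgeLottery k k' α j = (1 - (α : ℝ)) * v k + α * v k' := by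
  have h : ∀ j, edgeLottery k k' α j = (1 - (α : ℝ)) * pureLottery k j + α * pureLottery k' j :=
    fun j => rfl
  have hj : ∀ j, v j * edgeLottery k k' α j =
      (1 - (α : ℝ)) * (v j * pureLottery k j) + α * (v j * pureLottery k' j) := fun j => by
    rw [h]; ring
  rw [Finset.sum_congr rfl fun j _ => hj j, Finset.sum_add_distrib, ← Finset.mul_sum,
    ← Finset.mul_sum, sum_mul_pureLottery, sum_mul_pureLottery]

/-! ### Turning points on the edges of the simplex -/

namespace UtilityInstance

variable {n m : ℕ} {ε : ℝ} (I : UtilityInstance n m ε)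

theorem oracle_eq_true {i : Fin n} {x : Lottery m} :
    I.oracle i x = true ↔ x ∈ I.accepted i := by
  simp [oracle]

theorem mem_accepted {i : Fin n} {x : Lottery m} :
    x ∈ I.accepted i ↔ I.τ i ≤ ∑ j, I.u i j * x j := Iff.rfl

theorem oracle_pureLottery {i : Fin n} {j : Fin m} :
    I.oracle i (pureLottery j) = true ↔ I.τ i ≤ I.u i j := by
  rw [oracle_eq_true, mem_accepted, sum_mul_pureLottery]

/-- The point of the edge from `e_k` to `e_{k'}` at which agent `i` starts to accept. -/
noncomputable def turningPoint (i : Fin n) (k k' : Fin m) : ℝ :=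
  (I.τ i - I.u i k) / (I.u i k' - I.u i k)

theorem oracle_edgeLottery {i : Fin n} {k k' : Fin m} (hk : I.u i k < I.τ i)
    (hk' : I.τ i ≤ I.u i k') (α : unitInterval) :
    I.oracle i (edgeLottery k k' α) = true ↔ I.turningPoint i k k' ≤ α := by
  have h : 0 < I.u i k' - I.u i k := by linarith
  rw [oracle_eq_true, mem_accepted, sum_mul_edgeLottery, turningPoint, div_le_iff₀ h]
  constructor <;> intro h <;> nlinarith

theorem turningPoint_pos {i : Fin n} {k k' : Fin m} (hk : I.u i k < I.τ i)
    (hk' : I.τ i ≤ I.u i k') : 0 < I.turningPoint i k k' :=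
  div_pos (by linarith) (by linarith)

theorem turningPoint_le_one {i : Fin n} {k k' : Fin m} (hk : I.u i k < I.τ i)
    (hk' : I.τ i ≤ I.u i k') : I.turningPoint i k k' ≤ 1 :=
  (div_le_one (by linarith)).2 (by linarith)

/-- The factor `ε` cancels from the quotient, leaving as denominator a difference of utilities in
units of `ε`, which is at most `1/ε`. -/
theorem turningPoint_eq_fraction (hε : 0 < ε) {Q : ℕ} (hQ : 1 / ε = Q) {i : Fin n} {k k' : Fin m}
    (hk : I.u i k < I.τ i) (hk' : I.τ i ≤ I.u i k') :
    ∃ (p : ℤ) (q : ℕ), 1 ≤ q ∧ q ≤ Q ∧ I.turningPoint i k k' = p / q := by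
  obtain ⟨a, ha⟩ := I.u_quantized i k
  obtain ⟨b, hb⟩ := I.u_quantized i k'
  obtain ⟨t, -, ht⟩ := I.τ_quantized i
  have hab : a < b := by
    have : (a : ℝ) * ε < b * ε := by rw [← ha, ← hb]; linarith
    exact_mod_cast lt_of_mul_lt_mul_right this hε.le
  have hbQ : (b : ℝ) ≤ Q := by
    rw [← hQ, le_div_iff₀ hε, ← hb]
    exact I.u_le_one i k'
  have hbQ' : b ≤ Q := by exact_mod_cast hbQ
  refine ⟨(t : ℤ) - a, b - a, by omega, by omega, ?_⟩
  rw [turningPoint, ha, hb, ht, ← sub_mul, ← sub_mul, mul_div_mul_right _ _ hε.ne',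
    Nat.cast_sub hab.le]
  push_cast
  rfl

end UtilityInstance

/-- Distinct fractions with denominators at most `Q` differ by at least `1/Q² = ε²`, more than the
bracket allows. The search may stop at a denominator other than `q`, but only with the same value.
-/
theorem reconstruct_eq {ε l u : ℝ} (hε : 0 < ε) {Q : ℕ} (hQ : 1 / ε = Q) {p : ℤ} {q : ℕ}
    (hq : 1 ≤ q) (hqQ : q ≤ Q) (hl : l < (p : ℝ) / q) (hu : (p : ℝ) / q ≤ u)
    (hlu : u - l < ε ^ 2 / 2) : reconstruct Q l u = (p : ℝ) / q := by
  have hq0 : (0 : ℝ) < q := by exact_mod_cast hq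
  have hmem : q ∈ List.range' 1 Q := by rw [List.mem_range'_1]; omega
  have hceil : ((⌈(q : ℝ) * l⌉ : ℤ) : ℝ) / q ≤ u := by
    refine le_trans ?_ hu
    gcongr
    rw [Int.ceil_le]
    rw [lt_div_iff₀ hq0] at hl
    linarith
  unfold reconstruct
  split
  · rename_i q' h
    have h1 := List.mem_of_find?_eq_some h
    have h2 := List.find?_some h
    rw [List.mem_range'_1] at h1
    simp only [decide_eq_true_eq] at h2
    have hq'0 : (0 : ℝ) < q' := by exact_mod_cast h1.1
    have hQε : (Q : ℝ) * ε = 1 := by rw [← hQ, one_div, inv_mul_cancel₀ hε.ne']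
    have hle : l ≤ (⌈(q' : ℝ) * l⌉ : ℝ) / q' := by
      rw [le_div_iff₀ hq'0, mul_comm]
      exact Int.le_ceil _
    set c : ℤ := ⌈(q' : ℝ) * l⌉
    have habs : |(c : ℝ) / q' - p / q| < ε ^ 2 := by
      rw [abs_lt]
      constructor <;> nlinarith [sq_nonneg ε]
    have hqε : (q : ℝ) * ε ≤ 1 := by
      rw [← hQε]
      gcongr
    have hq'ε : (q' : ℝ) * ε ≤ 1 := by
      rw [← hQε]
      gcongr
      exact_mod_cast (by omega : q' ≤ Q)
    have heq : (c : ℝ) / q' - p / q = (c * q - p * q') / (q' * q) := by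
      field_simp
    rw [heq, abs_div, abs_of_pos (mul_pos hq'0 hq0), div_lt_iff₀ (mul_pos hq'0 hq0)] at habs
    have hlt : |(c : ℝ) * q - p * q'| < 1 := by
      refine habs.trans_le ?_
      calc ε ^ 2 * (q' * q) = (q' * ε) * (q * ε) := by ring
        _ ≤ 1 * 1 := by gcongr
        _ = 1 := one_mul 1
    have hint : c * q - p * q' = 0 := by
      rw [← Int.abs_lt_one_iff]
      exact_mod_cast hlt
    have hreal : (c : ℝ) * q = p * q' := by exact_mod_cast sub_eq_zero.1 hint
    rw [div_eq_div_iff hq'0.ne' hq0.ne', hreal]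
  · rename_i h
    rw [List.find?_eq_none] at h
    exact absurd (decide_eq_true hceil) (h q hmem)

/-! ### Learning one agent -/

section Learn

variable {n m : ℕ} {ε : ℝ} (I : UtilityInstance n m ε)

/-- In the cost bound each query pays one factor of `2` as the bracket halves; the maximum with `1`
covers a bracket that is already short enough. -/
theorem bisect_spec (hε : 0 < ε) {i : Fin n} {k k' : Fin m} (hk : I.u i k < I.τ i)
    (hk' : I.τ i ≤ I.u i k') (l u : unitInterval) (hl : (l : ℝ) < I.turningPoint i k k')
    (hu : I.turningPoint i k k' ≤ u) :
    (((bisect ε i k k' l u).run I.oracle).1.1 : ℝ) < I.turningPoint i k k' ∧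
    I.turningPoint i k k' ≤ ((bisect ε i k k' l u).run I.oracle).1.2 ∧
    (((bisect ε i k k' l u).run I.oracle).1.2 : ℝ) -
      ((bisect ε i k k' l u).run I.oracle).1.1 < ε ^ 2 / 2 ∧
    (2 : ℝ) ^ ((bisect ε i k k' l u).run I.oracle).2 ≤ max 1 (2 * (u - l) / (ε ^ 2 / 2)) := by
  have hd : 0 < ε ^ 2 / 2 := by positivity
  induction l, u using bisect.induct (ε := ε) with
  | case1 l u h ih1 ih2 =>
    rw [bisect, dif_pos h]
    simp only [QueryComp.run]
    have hbig : 1 ≤ (u - l : ℝ) / (ε ^ 2 / 2) := by rw [le_div_iff₀ hd, one_mul]; exact h.2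
    have hcost : ∀ c : ℕ, (2 : ℝ) ^ c ≤ max 1 (2 * ((u - l) / 2) / (ε ^ 2 / 2)) →
        (2 : ℝ) ^ (c + 1) ≤ max 1 (2 * (u - l) / (ε ^ 2 / 2)) := by
      intro c hc
      have e : 2 * ((u - l : ℝ) / 2) / (ε ^ 2 / 2) = (u - l : ℝ) / (ε ^ 2 / 2) := by ring
      rw [e, max_eq_right hbig] at hc
      refine le_trans ?_ (le_max_right _ _)
      rw [pow_succ, mul_div_assoc]
      linarith
    by_cases hb : I.oracle i (edgeLottery k k' (mid l u)) = true
    · rw [if_pos hb]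
      have := (I.oracle_edgeLottery hk hk' _).1 hb
      obtain ⟨h1, h2, h3, h4⟩ := ih1 hl this
      refine ⟨h1, h2, h3, hcost _ ?_⟩
      convert h4 using 4
      rw [coe_mid]; ring
    · rw [if_neg hb]
      have := lt_of_not_ge (mt (I.oracle_edgeLottery hk hk' _).2 hb)
      obtain ⟨h1, h2, h3, h4⟩ := ih2 this hu
      refine ⟨h1, h2, h3, hcost _ ?_⟩
      convert h4 using 4
      rw [coe_mid]; ring
  | case2 l u h =>
    rw [bisect, dif_neg h]
    simp only [QueryComp.run]
    refine ⟨hl, hu, ?_, by simp⟩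
    by_contra hcon
    exact h ⟨hε, not_lt.1 hcon⟩

theorem exactThreshold_spec (hε : 0 < ε) {Q : ℕ} (hQ : 1 / ε = Q) {i : Fin n}
    {k k' : Fin m} (hk : I.u i k < I.τ i) (hk' : I.τ i ≤ I.u i k') :
    ((exactThreshold ε i k k').run I.oracle).1 = I.turningPoint i k k' := by
  obtain ⟨h1, h2, h3, -⟩ := bisect_spec I hε hk hk' 0 1 (by simpa using I.turningPoint_pos hk hk')
    (by simpa using I.turningPoint_le_one hk hk')
  simp only [exactThreshold, QueryComp.run_bind, QueryComp.run_pure]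
  obtain ⟨p, q, hq, hqQ, he⟩ := I.turningPoint_eq_fraction hε hQ hk hk'
  rw [he] at h1 h2 ⊢
  rw [hQ, Nat.floor_natCast]
  exact reconstruct_eq hε hQ hq hqQ h1 h2 h3

theorem exactThreshold_cost (hε : 0 < ε) (hε2 : ε ≤ 1 / 2) {i : Fin n}
    {k k' : Fin m} (hk : I.u i k < I.τ i) (hk' : I.τ i ≤ I.u i k') :
    (((exactThreshold ε i k k').run I.oracle).2 : ℝ) ≤ 6 * Real.log (1 / ε) := by
  obtain ⟨-, -, -, h⟩ := bisect_spec I hε hk hk' 0 1 (by simpa using I.turningPoint_pos hk hk')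
    (by simpa using I.turningPoint_le_one hk hk')
  simp only [exactThreshold, QueryComp.run_bind, QueryComp.run_pure, add_zero]
  set c := ((bisect ε i k k' 0 1).run I.oracle).2
  have hinv : 2 ≤ 1 / ε := by rw [le_div_iff₀ hε]; linarith
  -- Bisection gives `4/ε²`, and `4 ≤ (1/ε)²`. The constant `6` then exceeds `4 / log 2`.
  have h2 : (2 : ℝ) ^ c ≤ (1 / ε) ^ 4 := by
    refine h.trans (max_le (one_le_pow₀ (by linarith)) ?_)
    have e : 2 * (((1 : unitInterval) : ℝ) - ((0 : unitInterval) : ℝ)) / (ε ^ 2 / 2) =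
        2 ^ 2 * (1 / ε) ^ 2 := by
      simp only [Set.Icc.coe_one, Set.Icc.coe_zero]; field_simp; norm_num
    rw [e]
    calc (2 : ℝ) ^ 2 * (1 / ε) ^ 2 ≤ (1 / ε) ^ 2 * (1 / ε) ^ 2 := by gcongr
      _ = (1 / ε) ^ 4 := by ring
  have h3 := Real.log_le_log (by positivity) h2
  rw [Real.log_pow, Real.log_pow] at h3
  have h4 := Real.log_two_gt_d9
  push_cast at h3
  have h5 : 0 ≤ Real.log (1 / ε) := Real.log_nonneg (by linarith)
  nlinarith [Nat.cast_nonneg (α := ℝ) c]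

/-- What it means that a result of `LearnHyperplane` describes the acceptance set of agent `i`. -/
def Describes (i : Fin n) : Learned m → Prop
  | .acceptAll => I.accepted i = Set.univ
  | .rejectAll => I.accepted i = ∅
  | .halfspace c => I.accepted i = {x | 1 ≤ ∑ j, c j * x j}

/-- Halfspaces of the simplex do not change if a constant is subtracted from normal vector and
threshold and both are rescaled. -/
theorem accepted_eq_of_affine {i : Fin n} {c : Fin m → ℝ} {s : ℝ} (hs : s < I.τ i)
    (hc : ∀ j, I.u i j - s = (I.τ i - s) * c j) : I.accepted i = {x | 1 ≤ ∑ j, c j * x j} := by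
  ext x
  have hx : ∑ j, x j = 1 := x.2.2
  have h1 : ∑ j, I.u i j * x j - s = (I.τ i - s) * ∑ j, c j * x j := by
    calc ∑ j, I.u i j * x j - s = ∑ j, I.u i j * x j - s * ∑ j, x j := by rw [hx, mul_one]
      _ = ∑ j, (I.u i j - s) * x j := by
        rw [Finset.mul_sum, ← Finset.sum_sub_distrib]
        exact Finset.sum_congr rfl fun j _ => by ring
      _ = _ := by
        rw [Finset.mul_sum]
        exact Finset.sum_congr rfl fun j _ => by rw [hc]; ring
  rw [I.mem_accepted, Set.mem_ofPred_eq]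
  have h2 : 0 < I.τ i - s := by linarith
  constructor <;> intro h <;> nlinarith

/-- No utility exceeds the threshold, so a lottery reaches it only by putting no mass outside `A`;
the indicator inequality says the same. -/
theorem accepted_eq_indicator {i : Fin n} {A : Finset (Fin m)} (hA : ∀ j ∈ A, I.u i j = I.τ i)
    (hA' : ∀ j ∉ A, I.u i j < I.τ i) :
    I.accepted i = {x | 1 ≤ ∑ j, (if j ∈ A then 1 else 0) * x j} := by
  ext x
  have hx : ∑ j, x j = 1 := x.2.2
  have hx0 : ∀ j, 0 ≤ x j := x.2.1
  rw [I.mem_accepted, Set.mem_ofPred_eq]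
  have h1 : ∑ j, (if j ∈ A then (1 : ℝ) else 0) * x j = 1 - ∑ j, (if j ∈ A then 0 else 1) * x j := by
    rw [eq_sub_iff_add_eq, ← Finset.sum_add_distrib]
    exact (Finset.sum_congr rfl fun j _ => by split_ifs <;> ring).trans hx
  have h2 : ∑ j, I.u i j * x j = I.τ i - ∑ j, (if j ∈ A then 0 else I.τ i - I.u i j) * x j := by
    rw [eq_sub_iff_add_eq, ← Finset.sum_add_distrib]
    calc _ = ∑ j, I.τ i * x j := Finset.sum_congr rfl fun j _ => by
          split_ifs with h
          · rw [hA j h]; ring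
          · ring
      _ = _ := by rw [← Finset.mul_sum, hx, mul_one]
  have hn1 : ∀ j, 0 ≤ (if j ∈ A then (0 : ℝ) else 1) * x j := fun j =>
    mul_nonneg (by split_ifs <;> norm_num) (hx0 j)
  have hn2 : ∀ j, 0 ≤ (if j ∈ A then 0 else I.τ i - I.u i j) * x j := fun j =>
    mul_nonneg (by split_ifs with h; exacts [le_rfl, (sub_pos.2 (hA' j h)).le]) (hx0 j)
  have e1 : (1 : ℝ) ≤ 1 - ∑ j, (if j ∈ A then (0 : ℝ) else 1) * x j ↔
      ∑ j, (if j ∈ A then (0 : ℝ) else 1) * x j = 0 :=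
    ⟨fun h => le_antisymm (by linarith) (Finset.sum_nonneg fun j _ => hn1 j), fun h => by linarith⟩
  have e2 : I.τ i ≤ I.τ i - ∑ j, (if j ∈ A then 0 else I.τ i - I.u i j) * x j ↔
      ∑ j, (if j ∈ A then 0 else I.τ i - I.u i j) * x j = 0 :=
    ⟨fun h => le_antisymm (by linarith) (Finset.sum_nonneg fun j _ => hn2 j), fun h => by linarith⟩
  rw [h1, h2, e1, e2, Finset.sum_eq_zero_iff_of_nonneg fun j _ => hn1 j,
    Finset.sum_eq_zero_iff_of_nonneg fun j _ => hn2 j]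
  refine forall₂_congr fun j _ => ?_
  split_ifs with h
  · simp
  · simp [(sub_pos.2 (hA' j h)).ne']

end Learn

/-! ### Correctness and cost of `LearnHyperplane` -/

section LearnHyperplane

variable {n m : ℕ} {ε : ℝ} (I : UtilityInstance n m ε)

theorem list_sum_map_filter_le {ι : Type} (l : List ι) (p : ι → Bool) (f : ι → ℕ) {b : ℝ}
    (hf : ∀ j, p j = true → (f j : ℝ) ≤ b) :
    (((l.filter p).map f).sum : ℝ) ≤ (l.filter p).length * b := by
  induction l with
  | nil => simp
  | cons a l ih =>
    by_cases h : p a = true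
    · simp only [List.filter_cons_of_pos h, List.map_cons, List.sum_cons, List.length_cons]
      rw [Nat.cast_add, Nat.cast_add, Nat.cast_one]
      linarith [hf a h]
    · simpa only [List.filter_cons_of_neg h] using ih

theorem length_filter_finRange (A : Finset (Fin m)) :
    ((List.finRange m).filter (fun j => decide (j ∈ A))).length = A.card := by
  rw [← List.toFinset_card_of_nodup ((List.nodup_finRange m).filter _)]
  congr 1
  ext j
  simp

/-- After subtracting `u_r`, the normalized normal vector is `c_j = (u_j - u_r) / (τ - u_r)`. For
accepted `j` this is `1/α_{r,j}`; for rejected `k` it is solved from the turning point on the edge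
from `k` to `a`. -/
theorem learnHyperplane_spec (hε : 0 < ε) (hε2 : ε ≤ 1 / 2) {Q : ℕ} (hQ : 1 / ε = Q)
    {pick : Finset (Fin m) → Fin m} (hpick : ∀ s : Finset (Fin m), s.Nonempty → pick s ∈ s)
    (i : Fin n) :
    Describes I i ((learnHyperplane ε pick i).run I.oracle).1 ∧
      (((learnHyperplane ε pick i).run I.oracle).2 : ℝ) ≤ 8 * m * Real.log (1 / ε) := by
  classical
  set b : ℝ := 6 * Real.log (1 / ε) with hb
  have hinv : 2 ≤ 1 / ε := by rw [le_div_iff₀ hε]; linarith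
  have hlog : 0.69 ≤ Real.log (1 / ε) :=
    le_trans (by linarith [Real.log_two_gt_d9]) (Real.log_le_log two_pos hinv)
  have hb0 : 0 ≤ b := by rw [hb]; linarith
  -- Since `1/ε ≥ 2`, the `m` queries of pure lotteries are absorbed into the logarithmic term.
  have hm : (m : ℝ) ≤ m * (2 * Real.log (1 / ε)) :=
    le_mul_of_one_le_right (Nat.cast_nonneg m) (by linarith)
  have hmb : (0 : ℝ) ≤ m * b := by positivity
  have hmb' : (m : ℝ) * (2 * Real.log (1 / ε)) + m * b = 8 * m * Real.log (1 / ε) := by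
    rw [hb]; ring
  unfold learnHyperplane
  simp only [QueryComp.run_bind, QueryComp.run_table, QueryComp.run_ask, List.mem_finRange, if_true]
  have hmap : ((List.finRange m).map fun _ => 1).sum = m := by simp
  rw [hmap]
  set Lacc : Finset (Fin m) := Finset.univ.filter fun j => I.oracle i (pureLottery j) = true with hA
  set Lrej : Finset (Fin m) := Finset.univ.filter fun j => I.oracle i (pureLottery j) = false with hR
  have hacc : ∀ j, j ∈ Lacc ↔ I.τ i ≤ I.u i j := fun j => by
    rw [hA, Finset.mem_filter_univ, I.oracle_pureLottery]
  have hrej : ∀ j, j ∈ Lrej ↔ I.u i j < I.τ i := fun j => by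
    rw [hR, Finset.mem_filter_univ, ← not_le, ← I.oracle_pureLottery, Bool.not_eq_true]
  have hcard : Lacc.card + Lrej.card ≤ m := by
    rw [← Finset.card_union_of_disjoint]
    · exact (Finset.card_le_univ _).trans_eq (Fintype.card_fin m)
    · exact Finset.disjoint_left.2 fun j h1 h2 =>
        absurd ((hacc j).1 h1) (not_le.2 ((hrej j).1 h2))
  split_ifs with h1 h2
  · rw [QueryComp.run_pure]
    refine ⟨Set.eq_univ_iff_forall.2 fun x => ?_, by push_cast; linarith⟩
    have hall : ∀ j, I.τ i ≤ I.u i j := fun j => by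
      by_contra h
      have := (hrej j).2 (not_le.1 h)
      rw [h1] at this
      exact absurd this (Finset.notMem_empty j)
    rw [I.mem_accepted]
    calc I.τ i = ∑ j, I.τ i * x j := by rw [← Finset.mul_sum, show ∑ j, x j = 1 from x.2.2, mul_one]
      _ ≤ _ := Finset.sum_le_sum fun j _ => mul_le_mul_of_nonneg_right (hall j) (x.2.1 j)
  · rw [QueryComp.run_pure]
    refine ⟨Set.eq_empty_iff_forall_notMem.2 fun x hx => ?_, by push_cast; linarith⟩
    have hall : ∀ j, I.u i j < I.τ i := fun j => by
      by_contra h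
      have := (hacc j).2 (not_lt.1 h)
      rw [h2] at this
      exact absurd this (Finset.notMem_empty j)
    rw [I.mem_accepted] at hx
    have hx1 : ∑ j, x j = 1 := x.2.2
    obtain ⟨j₀, -, hj₀⟩ : ∃ j ∈ Finset.univ, 0 < x j := by
      by_contra! hcon
      linarith [Finset.sum_nonpos hcon]
    have : ∑ j, I.u i j * x j < ∑ j, I.τ i * x j :=
      Finset.sum_lt_sum (fun j _ => mul_le_mul_of_nonneg_right (hall j).le (x.2.1 j))
        ⟨j₀, Finset.mem_univ _, mul_lt_mul_of_pos_right (hall j₀) hj₀⟩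
    rw [← Finset.mul_sum, hx1, mul_one] at this
    linarith
  · have hr := hpick Lrej (Finset.nonempty_iff_ne_empty.2 h1)
    set r := pick Lrej
    rw [hrej] at hr
    rw [QueryComp.run_bind]
    generalize hR₁ : QueryComp.run I.oracle (QueryComp.table (fun j => exactThreshold ε i r j) 0
      ((List.finRange m).filter fun j => decide (j ∈ Lacc))) = R₁
    rw [QueryComp.run_table] at hR₁
    have hcost₁ : (R₁.2 : ℝ) ≤ Lacc.card * b := by
      rw [← hR₁]
      refine (list_sum_map_filter_le _ _ _ fun j hj => ?_).trans_eq
        (by rw [length_filter_finRange])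
      exact exactThreshold_cost I hε hε2 hr ((hacc j).1 (of_decide_eq_true hj))
    have hα : ∀ j ∈ Lacc, R₁.1 j = I.turningPoint i r j := fun j hj => by
      rw [← hR₁]
      simp only
      rw [if_pos (by simp [hj])]
      exact exactThreshold_spec I hε hQ hr ((hacc j).1 hj)
    clear hR₁
    obtain ⟨α, q₁⟩ := R₁
    simp only at hcost₁ hα ⊢
    have hcm : (Lacc.card : ℝ) * b ≤ m * b := by
      gcongr
      exact (Nat.le_add_right _ _).trans hcard
    by_cases h3 : ∀ j ∈ Lacc, α j = 1
    · rw [if_pos h3]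
      rw [QueryComp.run_pure]
      refine ⟨accepted_eq_indicator I (fun j hj => ?_) (fun j hj => ?_),
        by simp only [Nat.cast_add, Nat.cast_zero]; linarith⟩
      · have := (hα j hj).symm.trans (h3 j hj)
        have hj' := (hacc j).1 hj
        rw [UtilityInstance.turningPoint, div_eq_one_iff_eq (by linarith)] at this
        linarith
      · rw [hacc] at hj
        exact not_le.1 hj
    · rw [if_neg h3]
      have hne : (Lacc.filter fun j => α j < 1).Nonempty := by
        push Not at h3
        obtain ⟨j, hj, hj1⟩ := h3
        refine ⟨j, Finset.mem_filter.2 ⟨hj, lt_of_le_of_ne ?_ hj1⟩⟩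
        rw [hα j hj]
        exact I.turningPoint_le_one hr ((hacc j).1 hj)
      have ha := hpick _ hne
      set a := pick (Lacc.filter fun j => α j < 1)
      rw [Finset.mem_filter] at ha
      obtain ⟨haA, ha1⟩ := ha
      have haτ := (hacc a).1 haA
      -- Now `ha1` says that `a` is strictly above the threshold, which keeps the denominators `1 -
      -- α_{k,a}` nonzero.
      rw [hα a haA, UtilityInstance.turningPoint, div_lt_one (by linarith)] at ha1
      rw [QueryComp.run_bind]
      generalize hR₂ : QueryComp.run I.oracle (QueryComp.table (fun k => exactThreshold ε i k a) 0
        ((List.finRange m).filter fun k => decide (k ∈ Lrej.erase r))) = R₂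
      rw [QueryComp.run_table] at hR₂
      have hcost₂ : (R₂.2 : ℝ) ≤ (Lrej.erase r).card * b := by
        rw [← hR₂]
        refine (list_sum_map_filter_le _ _ _ fun k hk => ?_).trans_eq
          (by rw [length_filter_finRange])
        exact exactThreshold_cost I hε hε2
          ((hrej k).1 (Finset.mem_of_mem_erase (of_decide_eq_true hk))) haτ
      have hα' : ∀ k ∈ Lrej.erase r, R₂.1 k = I.turningPoint i k a := fun k hk => by
        rw [← hR₂]
        simp only
        rw [if_pos (by simpa using hk)]
        exact exactThreshold_spec I hε hQ ((hrej k).1 (Finset.mem_of_mem_erase hk)) haτ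
      clear hR₂
      obtain ⟨α', q₂⟩ := R₂
      simp only at hcost₂ hα' ⊢
      rw [QueryComp.run_pure]
      have hcard' : (Lacc.card : ℝ) * b + (Lrej.erase r).card * b ≤ m * b := by
        rw [← add_mul]
        gcongr
        have := Finset.card_erase_le (s := Lrej) (a := r)
        exact_mod_cast (by omega : Lacc.card + (Lrej.erase r).card ≤ m)
      refine ⟨accepted_eq_of_affine I hr fun j => ?_, by
        simp only [Nat.cast_add, Nat.cast_zero]; linarith⟩
      have hτ0 : I.τ i - I.u i r ≠ 0 := by linarith
      split_ifs with hjr hjA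
      · rw [hjr]; ring
      · have := (hacc j).1 hjA
        have hj0 : I.u i j - I.u i r ≠ 0 := by linarith
        rw [hα j hjA, UtilityInstance.turningPoint]
        field_simp
      · have hjτ : I.u i j < I.τ i := not_le.1 (mt (hacc j).2 hjA)
        rw [hα' j (Finset.mem_erase.2 ⟨hjr, (hrej j).2 hjτ⟩), hα a haA, UtilityInstance.turningPoint,
          UtilityInstance.turningPoint]
        have e1 : I.u i a - I.u i j ≠ 0 := by linarith
        have e2 : I.u i a - I.u i r ≠ 0 := by linarith
        have e3 : I.u i a - I.τ i ≠ 0 := by linarith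
        have e4 : 1 - (I.τ i - I.u i j) / (I.u i a - I.u i j) =
            (I.u i a - I.τ i) / (I.u i a - I.u i j) := by
          field_simp; ring
        rw [e4]
        field_simp
        ring

end LearnHyperplane

/-! ### One pass through the loop -/

namespace AlgState

variable {n m : ℕ} {ε : ℝ}

/-- The agents that are not learned yet. -/
def unknown (s : AlgState n m) : Finset (Fin n) := Finset.univ.filter fun i => s.known i = false

/-- The stored data of every learned agent describe its acceptance set. -/
def Sound (I : UtilityInstance n m ε) (s : AlgState n m) : Prop :=
  ∀ i, s.known i = true → (s.c i = none → I.accepted i = Set.univ) ∧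
    ∀ c, s.c i = some c → I.accepted i = {x | 1 ≤ ∑ j, c j * x j}

end AlgState

section Loop

variable {n m : ℕ} {ε : ℝ} (I : UtilityInstance n m ε)

theorem sound_update {I : UtilityInstance n m ε} {s : AlgState n m} (hs : s.Sound I) {i : Fin n}
    {o : Option (Fin m → ℝ)} (h1 : o = none → I.accepted i = Set.univ)
    (h2 : ∀ c, o = some c → I.accepted i = {x | 1 ≤ ∑ j, c j * x j}) :
    AlgState.Sound I { s with known := Function.update s.known i true, c := Function.update s.c i o } := by
  intro k hk
  by_cases hki : k = i
  · subst hki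
    simpa using ⟨h1, h2⟩
  · simp only [Function.update_of_ne hki] at hk ⊢
    exact hs k hk

theorem unknown_update {s : AlgState n m} {i : Fin n} {c : Fin n → Option (Fin m → ℝ)} :
    AlgState.unknown { s with known := Function.update s.known i true, c := c } =
      s.unknown.erase i := by
  ext k
  by_cases hki : k = i
  · subst hki; simp [AlgState.unknown]
  · simp [AlgState.unknown, hki]

/-- `L` times the number of unlearned agents is a potential that pays for learning across passes.
The bound by the length of the list instead serves the charge per pass. -/
theorem learnSample_spec {pick : Finset (Fin m) → Fin m} {L : ℝ} (hL0 : 0 ≤ L)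
    (hL : ∀ i, Describes I i ((learnHyperplane ε pick i).run I.oracle).1 ∧
      (((learnHyperplane ε pick i).run I.oracle).2 : ℝ) ≤ L)
    (l : List (Fin n)) (s : AlgState n m) (hs : s.Sound I) :
    (((learnSample ε pick l s).run I.oracle).2 : ℝ) ≤ L * l.length ∧
    (((learnSample ε pick l s).run I.oracle).2 : ℝ) ≤ L * s.unknown.card ∧
    (((learnSample ε pick l s).run I.oracle).1 = none → ∃ i, I.accepted i = ∅) ∧
    ∀ s', ((learnSample ε pick l s).run I.oracle).1 = some s' →
      s'.Sound I ∧ s'.w = s.w ∧ (∀ i, s.known i = true → s'.known i = true) ∧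
      (∀ i ∈ l, s'.known i = true) ∧
      (((learnSample ε pick l s).run I.oracle).2 : ℝ) + L * s'.unknown.card ≤
        L * s.unknown.card := by
  induction l generalizing s with
  | nil =>
    simp only [learnSample, QueryComp.run_pure, List.length_nil, Nat.cast_zero, mul_zero, le_refl,
      zero_add, true_and, reduceCtorEq, false_implies, Option.some.injEq, List.not_mem_nil,
      implies_true]
    refine ⟨by positivity, ?_⟩
    rintro s' rfl
    exact ⟨hs, rfl, fun _ h => h, le_rfl⟩
  | cons i l ih =>
    by_cases hk : s.known i = true
    · rw [learnSample, if_pos hk]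
      obtain ⟨h1, h2, h3, h4⟩ := ih s hs
      refine ⟨h1.trans (by gcongr; simp), h2, h3, fun s' hs' => ?_⟩
      obtain ⟨g1, g2, g3, g4, g5⟩ := h4 s' hs'
      refine ⟨g1, g2, g3, fun k hkl => ?_, g5⟩
      rcases List.mem_cons.1 hkl with rfl | h
      · exact g3 k hk
      · exact g4 k h
    · rw [learnSample, if_neg hk, QueryComp.run_bind]
      obtain ⟨hd, hc⟩ := hL i
      have hiu : i ∈ s.unknown := by simpa [AlgState.unknown] using hk
      have hcard : ((s.unknown.erase i).card : ℝ) + 1 = s.unknown.card := by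
        exact_mod_cast Finset.card_erase_add_one hiu
      have hrec : ∀ o : Option (Fin m → ℝ), (o = none → I.accepted i = Set.univ) →
          (∀ c, o = some c → I.accepted i = {x | 1 ≤ ∑ j, c j * x j}) → ∀ (q : ℕ), (q : ℝ) ≤ L →
          ∀ C : QueryComp n m (Option (AlgState n m)), C = learnSample ε pick l
            { s with known := Function.update s.known i true, c := Function.update s.c i o } →
          ((q + (C.run I.oracle).2 : ℕ) : ℝ) ≤ L * (i :: l).length ∧
          ((q + (C.run I.oracle).2 : ℕ) : ℝ) ≤ L * s.unknown.card ∧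
          ((C.run I.oracle).1 = none → ∃ i, I.accepted i = ∅) ∧
          ∀ s', (C.run I.oracle).1 = some s' →
            s'.Sound I ∧ s'.w = s.w ∧ (∀ i, s.known i = true → s'.known i = true) ∧
            (∀ k ∈ i :: l, s'.known k = true) ∧
            ((q + (C.run I.oracle).2 : ℕ) : ℝ) + L * s'.unknown.card ≤ L * s.unknown.card := by
        rintro o ho1 ho2 q hq C rfl
        obtain ⟨h1, h2, h3, h4⟩ := ih _ (sound_update hs ho1 ho2)
        rw [unknown_update] at h2 h4
        refine ⟨?_, ?_, h3, fun s' hs' => ?_⟩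
        · rw [Nat.cast_add, List.length_cons, Nat.cast_add, Nat.cast_one]
          linarith
        · rw [Nat.cast_add, ← hcard]
          linarith
        · obtain ⟨g1, g2, g3, g4, g5⟩ := h4 s' hs'
          refine ⟨g1, g2, fun k hk => g3 k ?_, fun k hkl => ?_, ?_⟩
          · by_cases hki : k = i
            · subst hki; simp
            · simpa [Function.update_of_ne hki] using hk
          · rcases List.mem_cons.1 hkl with rfl | h
            · exact g3 k (by simp)
            · exact g4 k h
          · rw [Nat.cast_add, ← hcard]
            linarith
      generalize (learnHyperplane ε pick i).run I.oracle = R at hd hc ⊢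
      obtain ⟨res, q⟩ := R
      simp only at hd hc ⊢
      cases res with
      | rejectAll =>
        simp only [QueryComp.run_pure, Nat.add_zero]
        refine ⟨hc.trans ?_, hc.trans ?_, fun _ => ⟨i, hd⟩, fun s' hs' => by simp at hs'⟩
        · rw [List.length_cons, Nat.cast_add, Nat.cast_one]
          nlinarith [mul_nonneg hL0 (Nat.cast_nonneg (α := ℝ) l.length)]
        · rw [← hcard]
          nlinarith [mul_nonneg hL0 (Nat.cast_nonneg (α := ℝ) (s.unknown.erase i).card)]
      | acceptAll => exact hrec none (fun _ => hd) (by simp) q hc _ rfl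
      | halfspace c =>
        exact hrec (some c) (by simp) (fun c' hc' => by
          cases hc'
          exact hd) q hc _ rfl

/-- A learned agent without stored vector accepts everything, so leaving it out of the constraints
is harmless. -/
theorem select_stored_eq {I : UtilityInstance n m ε} {s : AlgState n m} (hs : s.Sound I)
    {N' : Finset (Fin n)} (hN : ∀ i ∈ N', s.known i = true) :
    select {c | ∃ i ∈ N', s.c i = some c} = lexMax (I.feasible N') := by
  unfold select
  congr 1
  ext x
  constructor
  · intro h i hi
    obtain ⟨h1, h2⟩ := hs i (hN i hi)
    cases hc : s.c i with
    | none => rw [h1 hc]; trivial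
    | some c => rw [h2 c hc]; exact h c ⟨i, hi, hc⟩
  · rintro h c ⟨i, hi, hc⟩
    have := h i hi
    rwa [(hs i (hN i hi)).2 c hc] at this

/-- Correctness does not depend on the sample: `Null` appears only when some set of agents has no
commonly acceptable lottery, and a lottery only after all agents have accepted it. -/
theorem loopBody_spec {pick : Finset (Fin m) → Fin m} {L : ℝ} (hL0 : 0 ≤ L)
    (hL : ∀ i, Describes I i ((learnHyperplane ε pick i).run I.oracle).1 ∧
      (((learnHyperplane ε pick i).run I.oracle).2 : ℝ) ≤ L)
    (N' : Finset (Fin n)) (s : AlgState n m) (hs : s.Sound I) :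
    (((loopBody ε pick N' s).run I.oracle).2 : ℝ) ≤ n + L * N'.card ∧
    (((loopBody ε pick N' s).run I.oracle).2 : ℝ) ≤ n + L * s.unknown.card ∧
    (∀ o, ((loopBody ε pick N' s).run I.oracle).1 = Sum.inl o → I.CorrectOutput o) ∧
    ∀ s', ((loopBody ε pick N' s).run I.oracle).1 = Sum.inr s' →
      s'.Sound I ∧
      (((loopBody ε pick N' s).run I.oracle).2 : ℝ) + L * s'.unknown.card ≤
        n + L * s.unknown.card ∧
      ∃ x, IsLexMax (I.feasible N') x ∧ ¬ I.Unanimous x ∧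
        ∀ i, s'.w i = if I.oracle i x = true then s.w i else 2 * s.w i := by
  have hlen : ((List.finRange n).filter (fun i => decide (i ∈ N'))).length = N'.card :=
    length_filter_finRange N'
  obtain ⟨h1, h2, h3, h4⟩ := learnSample_spec I hL0 hL
    ((List.finRange n).filter (fun i => decide (i ∈ N'))) s hs
  rw [hlen] at h1
  unfold loopBody
  rw [QueryComp.run_bind]
  generalize (learnSample ε pick ((List.finRange n).filter (fun i => decide (i ∈ N'))) s).run
    I.oracle = R at h1 h2 h3 h4 ⊢
  obtain ⟨res, q⟩ := R
  simp only at h1 h2 h3 h4 ⊢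
  have hn : (0 : ℝ) ≤ n := Nat.cast_nonneg n
  cases res with
  | none =>
    simp only [QueryComp.run_pure, Nat.add_zero]
    refine ⟨by linarith, by linarith, fun o ho => ?_, fun s' hs' => by simp at hs'⟩
    cases ho
    obtain ⟨i, hi⟩ := h3 rfl
    refine ⟨?_, fun _ => rfl⟩
    rintro ⟨x, hx⟩
    have := hx i
    rw [hi] at this
    exact absurd this (Set.notMem_empty x)
  | some t =>
    obtain ⟨g1, g2, -, g4, g5⟩ := h4 t rfl
    simp only
    rw [select_stored_eq g1 fun i hi => g4 i (by simpa using hi)]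
    cases hlm : lexMax (I.feasible N') with
    | none =>
      simp only [QueryComp.run_pure, Nat.add_zero]
      refine ⟨by linarith, by linarith, fun o ho => ?_, fun s' hs' => by simp at hs'⟩
      cases ho
      refine ⟨?_, fun _ => rfl⟩
      rintro ⟨x, hx⟩
      obtain ⟨y, hy⟩ := I.exists_isLexMax_feasible (B := N') ⟨x, fun i _ => hx i⟩
      rw [lexMax_eq_some.2 hy] at hlm
      cases hlm
    | some x =>
      have hx := lexMax_eq_some.1 hlm
      simp only [QueryComp.run_bind, QueryComp.run_table, QueryComp.run_ask, List.mem_finRange,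
        if_true]
      have hmap : ((List.finRange n).map fun _ => 1).sum = n := by simp
      rw [hmap]
      by_cases hall : ∀ i, I.oracle i x = true
      · rw [if_pos hall]
        simp only [QueryComp.run_pure, Nat.add_zero, Nat.cast_add]
        refine ⟨by linarith, by linarith, fun o ho => ?_, fun s' hs' => by simp at hs'⟩
        cases ho
        have hu : I.Unanimous x := fun i => I.oracle_eq_true.1 (hall i)
        exact ⟨fun _ => ⟨x, rfl, hu⟩, fun h => absurd ⟨x, hu⟩ h⟩
      · rw [if_neg hall]
        simp only [QueryComp.run_pure, Nat.add_zero, Nat.cast_add]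
        refine ⟨by linarith, by linarith, fun o ho => by simp at ho, fun s' hs' => ?_⟩
        cases hs'
        refine ⟨g1, ?_, x, hx, fun hu => hall fun i => I.oracle_eq_true.2 (hu i), fun i => ?_⟩
        · change _ + L * (t.unknown.card : ℝ) ≤ _
          linarith
        · simp only [g2]

end Loop

/-! ### The sampling lemma -/

/-- Double counting of pairs of an `r`-set `R` and a violator `h ∉ R` by the `(r + 1)`-set
`insert h R`. -/
theorem sum_card_violators_le {α : Type*} [Fintype α] [DecidableEq α] (P : Finset α → α → Prop)
    [∀ R, DecidablePred (P R)] (D r : ℕ) (hP : ∀ R, ∀ h ∈ R, ¬ P R h)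
    (hD : ∀ R : Finset α, (R.filter fun h => P (R.erase h) h).card ≤ D) :
    (r + 1) * ∑ R ∈ Finset.powersetCard r (Finset.univ : Finset α),
        (Finset.univ.filter (P R)).card ≤
      D * ((Fintype.card α).choose r * (Fintype.card α - r)) := by
  have h1 : ∑ R ∈ Finset.powersetCard r (Finset.univ : Finset α), (Finset.univ.filter (P R)).card =
      ∑ R ∈ Finset.powersetCard (r + 1) (Finset.univ : Finset α),
        (R.filter fun h => P (R.erase h) h).card := by
    rw [← Finset.card_sigma, ← Finset.card_sigma]
    refine Finset.card_nbij' (fun z => ⟨insert z.2 z.1, z.2⟩) (fun z => ⟨z.1.erase z.2, z.2⟩)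
      ?_ ?_ ?_ ?_
    · rintro ⟨R, h⟩ hz
      simp only [Finset.coe_sigma, Set.mem_sigma_iff, Finset.mem_coe, Finset.mem_powersetCard,
        Finset.mem_filter, Finset.mem_univ, true_and, Finset.subset_univ] at hz ⊢
      have hh : h ∉ R := fun hh => hP R h hh hz.2
      rw [Finset.card_insert_of_notMem hh, Finset.erase_insert hh]
      exact ⟨by rw [hz.1], Finset.mem_insert_self _ _, hz.2⟩
    · rintro ⟨R, h⟩ hz
      simp only [Finset.coe_sigma, Set.mem_sigma_iff, Finset.mem_coe, Finset.mem_powersetCard,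
        Finset.mem_filter, Finset.mem_univ, true_and, Finset.subset_univ] at hz ⊢
      exact ⟨by rw [Finset.card_erase_of_mem hz.2.1, hz.1]; rfl, hz.2.2⟩
    · rintro ⟨R, h⟩ hz
      simp only [Finset.coe_sigma, Set.mem_sigma_iff, Finset.mem_coe, Finset.mem_powersetCard,
        Finset.mem_filter, Finset.mem_univ, true_and, Finset.subset_univ] at hz
      have hh : h ∉ R := fun hh => hP R h hh hz.2
      simp [Finset.erase_insert hh]
    · rintro ⟨R, h⟩ hz
      simp only [Finset.coe_sigma, Set.mem_sigma_iff, Finset.mem_coe, Finset.mem_powersetCard,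
        Finset.mem_filter, true_and, Finset.subset_univ] at hz
      simp [Finset.insert_erase hz.2.1]
  rw [h1, ← Nat.choose_succ_right_eq]
  calc (r + 1) * _ ≤ (r + 1) * ((Finset.powersetCard (r + 1) (Finset.univ : Finset α)).card * D) := by
        gcongr
        rw [← smul_eq_mul]
        exact Finset.sum_le_card_nsmul _ _ _ fun R _ => hD R
    _ = _ := by
        rw [Finset.card_powersetCard, Finset.card_univ]
        ring

section Sampling

variable {n m : ℕ} {ε : ℝ} (I : UtilityInstance n m ε)

/-- Agent `i` rejects the lexicographic optimum of the sample `R`. -/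
def Violates (w : Fin n → ℕ) (R : Finset (Σ i : Fin n, Fin (w i))) (i : Fin n) : Prop :=
  ∃ x, IsLexMax (I.feasible (R.image Sigma.fst)) x ∧ x ∉ I.accepted i

open Classical in
/-- The total weight of the agents that reject the lexicographic optimum of the sample `R`. -/
noncomputable def violatedWeight (w : Fin n → ℕ) (R : Finset (Σ i : Fin n, Fin (w i))) : ℕ :=
  ∑ i, if Violates I w R i then w i else 0

theorem not_violates_of_mem {w : Fin n → ℕ} {R : Finset (Σ i : Fin n, Fin (w i))}
    {h : Σ i : Fin n, Fin (w i)} (hh : h ∈ R) : ¬ Violates I w R h.1 := by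
  rintro ⟨x, hx, hxi⟩
  exact hxi (hx.1 _ (Finset.mem_image_of_mem _ hh))

theorem sum_violatedWeight_le (hm : 2 ≤ m) (w : Fin n → ℕ) :
    4 * m * ∑ R ∈ Finset.powersetCard (min (16 * (m - 1) ^ 2) (∑ i, w i))
        (Finset.univ : Finset (Σ i : Fin n, Fin (w i))), violatedWeight I w R ≤
      (∑ i, w i).choose (min (16 * (m - 1) ^ 2) (∑ i, w i)) * ∑ i, w i := by
  classical
  have hcard : Fintype.card (Σ i : Fin n, Fin (w i)) = ∑ i, w i := by simp [Fintype.card_sigma]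
  have hv : ∀ R, violatedWeight I w R =
      (Finset.univ.filter fun h : Σ i : Fin n, Fin (w i) => Violates I w R h.1).card := by
    intro R
    rw [Finset.card_filter, Fintype.sum_sigma]
    unfold violatedWeight
    refine Finset.sum_congr rfl fun i _ => ?_
    split_ifs <;> simp
  have key := sum_card_violators_le (fun (R : Finset (Σ i : Fin n, Fin (w i))) h =>
    Violates I w R h.1) m (min (16 * (m - 1) ^ 2) (∑ i, w i))
    (fun R h hh => not_violates_of_mem I hh) (by
      intro R
      set V := R.filter fun h => Violates I w (R.erase h) h.1 with hV
      have hV' : ∀ h ∈ V, h ∈ R ∧ Violates I w (R.erase h) h.1 := fun h hh => Finset.mem_filter.1 hh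
      -- An extreme copy is the only copy of its agent in `R`, since a second copy would still
      -- impose the constraint after removal. So extreme copies correspond to extreme agents, of
      -- which there are at most `m`.
      have hout : ∀ h ∈ V, ∀ h' ∈ R, h'.1 = h.1 → h' = h := by
        intro h hh h' hh' he
        by_contra hne
        have := not_violates_of_mem I (Finset.mem_erase.2 ⟨hne, hh'⟩)
        rw [he] at this
        exact this (hV' h hh).2
      rw [← Finset.card_image_of_injOn (f := Sigma.fst) (s := V)
        (fun h hh h' hh' he => hout h' hh' h (hV' h hh).1 he)]
      refine I.card_extreme_le (by omega) (R.image Sigma.fst) _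
        (Finset.image_subset_image (Finset.filter_subset _ _)) fun i hi => ?_
      obtain ⟨h, hh, rfl⟩ := Finset.mem_image.1 hi
      obtain ⟨x, hx, hxi⟩ := (hV' h hh).2
      refine ⟨x, ?_, hxi⟩
      convert hx using 2
      ext k
      simp only [Finset.mem_erase, Finset.mem_image]
      constructor
      · rintro ⟨hk, h', hh', rfl⟩
        exact ⟨h', ⟨fun he => hk (by rw [he]), hh'⟩, rfl⟩
      · rintro ⟨h', ⟨hne, hh'⟩, rfl⟩
        exact ⟨fun he => hne (hout h hh h' hh' he), h', hh', rfl⟩)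
  rw [hcard] at key
  simp only [← hv] at key
  set W := ∑ i, w i
  set S := ∑ R ∈ Finset.powersetCard (min (16 * (m - 1) ^ 2) W)
        (Finset.univ : Finset (Σ i : Fin n, Fin (w i))), violatedWeight I w R
  obtain ⟨k, rfl⟩ : ∃ k, m = k + 2 := ⟨m - 2, by omega⟩
  rw [show k + 2 - 1 = k + 1 by omega] at key ⊢
  rcases le_total W (16 * (k + 1) ^ 2) with h | h
  -- Here the whole multiset is drawn and nobody is left to violate.
  · rw [min_eq_right h] at key ⊢
    rw [Nat.sub_self, Nat.mul_zero, Nat.mul_zero] at key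
    have : S = 0 := by
      rcases Nat.mul_eq_zero.1 (Nat.le_zero.1 key) with h | h
      · omega
      · exact h
    rw [this]
    simp
  · rw [min_eq_left h] at key ⊢
    refine le_of_mul_le_mul_left (a := 16 * (k + 1) ^ 2 + 1) ?_ (Nat.succ_pos _)
    calc (16 * (k + 1) ^ 2 + 1) * (4 * (k + 2) * S)
        = 4 * (k + 2) * ((16 * (k + 1) ^ 2 + 1) * S) := by ring
      _ ≤ 4 * (k + 2) * ((k + 2) * (W.choose (16 * (k + 1) ^ 2) * (W - 16 * (k + 1) ^ 2))) := by
          gcongr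
      _ ≤ 4 * (k + 2) * ((k + 2) * (W.choose (16 * (k + 1) ^ 2) * W)) := by
          gcongr
          exact Nat.sub_le _ _
      _ = (4 * (k + 2) ^ 2) * (W.choose (16 * (k + 1) ^ 2) * W) := by ring
      _ ≤ _ := by
          gcongr
          -- This is `4 m² ≤ 16 (m - 1)² + 1`, from `m ≤ 2 (m - 1)`; it dictates the sample size.
          nlinarith

end Sampling

/-! ### Expectations -/

/-- The expectation of a nonnegative function. -/
noncomputable def expect {α : Type*} (p : PMF α) (f : α → ℝ≥0∞) : ℝ≥0∞ := ∑' a, p a * f a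

section Expect

variable {α β : Type*}

theorem expect_pure (a : α) (f : α → ℝ≥0∞) : expect (PMF.pure a) f = f a := by
  classical
  unfold expect
  rw [tsum_eq_single a]
  · simp
  · intro b hb
    simp [PMF.pure_apply, hb]

theorem expect_bind (p : PMF α) (g : α → PMF β) (f : β → ℝ≥0∞) :
    expect (p.bind g) f = expect p fun a => expect (g a) f := by
  unfold expect
  simp only [PMF.bind_apply, ← ENNReal.tsum_mul_right, ← ENNReal.tsum_mul_left]
  rw [ENNReal.tsum_comm]
  simp only [mul_assoc]

theorem expect_map (p : PMF α) (g : α → β) (f : β → ℝ≥0∞) :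
    expect (p.map g) f = expect p fun a => f (g a) := by
  rw [PMF.map, expect_bind]
  simp only [Function.comp, expect_pure]

theorem expect_mono (p : PMF α) {f g : α → ℝ≥0∞} (h : ∀ a, f a ≤ g a) : expect p f ≤ expect p g :=
  ENNReal.tsum_le_tsum fun a => mul_le_mul_right (h a) _

/-- Needed because the bound on the sample size holds only on the support of the sampling law. -/
theorem expect_mono_support (p : PMF α) {f g : α → ℝ≥0∞} (h : ∀ a ∈ p.support, f a ≤ g a) :
    expect p f ≤ expect p g := by
  refine ENNReal.tsum_le_tsum fun a => ?_
  by_cases ha : p a = 0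
  · rw [ha, zero_mul, zero_mul]
  · exact mul_le_mul_right (h a ((p.mem_support_iff a).2 ha)) _

theorem expect_const (p : PMF α) (c : ℝ≥0∞) : (expect p fun _ => c) = c := by
  unfold expect
  rw [ENNReal.tsum_mul_right, p.tsum_coe, one_mul]

theorem expect_add (p : PMF α) (f g : α → ℝ≥0∞) :
    (expect p fun a => f a + g a) = expect p f + expect p g := by
  unfold expect
  simp only [mul_add, ENNReal.tsum_add]

theorem expect_mul_left (p : PMF α) (c : ℝ≥0∞) (f : α → ℝ≥0∞) :
    (expect p fun a => c * f a) = c * expect p f := by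
  unfold expect
  rw [← ENNReal.tsum_mul_left]
  exact tsum_congr fun a => by ring

theorem expect_sum (p : PMF α) (s : Finset β) (f : β → α → ℝ≥0∞) :
    (expect p fun a => ∑ b ∈ s, f b a) = ∑ b ∈ s, expect p (f b) := by
  classical
  induction s using Finset.induction_on with
  | empty => simp [expect]
  | insert b s hb ih => simp only [Finset.sum_insert hb, expect_add, ih]

end Expect

theorem expect_violatedWeight_le {n m : ℕ} {ε : ℝ} (I : UtilityInstance n m ε) (hm : 2 ≤ m)
    (w : Fin n → ℕ) :
    (expect (weightedSample w (16 * (m - 1) ^ 2)) fun R => (violatedWeight I w R : ℝ≥0∞)) ≤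
      (4 * m : ℝ≥0∞)⁻¹ * (∑ i, w i : ℕ) := by
  classical
  set r := min (16 * (m - 1) ^ 2) (∑ i, w i) with hr
  have key := sum_violatedWeight_le I hm w
  rw [← hr] at key
  have hC : (∑ i, w i).choose r ≠ 0 := (Nat.choose_pos (min_le_right _ _)).ne'
  have h1 : (expect (weightedSample w (16 * (m - 1) ^ 2)) fun R => (violatedWeight I w R : ℝ≥0∞)) =
      ((∑ i, w i).choose r : ℝ≥0∞)⁻¹ * (∑ R ∈ Finset.powersetCard r
        (Finset.univ : Finset (Σ i : Fin n, Fin (w i))), violatedWeight I w R : ℕ) := by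
    unfold expect weightedSample
    rw [tsum_fintype, Nat.cast_sum, Finset.mul_sum, ← Finset.sum_filter_add_sum_filter_not
      Finset.univ (fun R => R ∈ Finset.powersetCard r Finset.univ)]
    rw [Finset.filter_mem_eq_inter, Finset.univ_inter, Finset.sum_eq_zero (s := Finset.filter _ _),
      add_zero]
    · refine Finset.sum_congr rfl fun R hR => ?_
      rw [PMF.uniformOfFinset_apply_of_mem _ hR, Finset.card_powersetCard]
      simp [Fintype.card_sigma]
    · intro R hR
      rw [PMF.uniformOfFinset_apply_of_notMem _ (Finset.mem_filter.1 hR).2, zero_mul]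
  rw [h1]
  have h4m : (4 * m : ℝ≥0∞) ≠ 0 := by
    have : m ≠ 0 := by omega
    simp [this]
  have h4m' : (4 * m : ℝ≥0∞) ≠ ⊤ := ENNReal.mul_ne_top (by simp) (by simp)
  rw [mul_comm, ← div_eq_mul_inv, ENNReal.div_le_iff (by exact_mod_cast hC) (by simp), mul_assoc,
    ← ENNReal.div_eq_inv_mul, ENNReal.le_div_iff_mul_le (Or.inl h4m) (Or.inl h4m')]
  rw [mul_comm, mul_comm ((∑ i, w i : ℕ) : ℝ≥0∞)]
  exact_mod_cast key

/-! ### The weight potential and the expected number of queries -/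

section Potential

variable {n m : ℕ} {ε : ℝ} (I : UtilityInstance n m ε) (pick : Finset (Fin m) → Fin m)

/-- The outcome of one pass through the loop on a given sample. -/
noncomputable def passOutcome (s : AlgState n m) (R : Finset (Σ i : Fin n, Fin (s.w i))) :
    (Option (Lottery m) ⊕ AlgState n m) × ℕ :=
  (loopBody ε pick (R.image Sigma.fst) s).run I.oracle

theorem expect_runFor_zero (s : AlgState n m)
    (f : (Option (Lottery m) ⊕ AlgState n m) × ℕ → ℝ≥0∞) :
    expect (runFor ε pick I.oracle 0 s) f = f (Sum.inr s, 0) := by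
  rw [runFor, expect_pure]

/-- Conditions on the first pass, so that estimates for `t` passes follow by induction with varying
initial state. -/
theorem expect_runFor_succ (t : ℕ) (s : AlgState n m)
    (f : (Option (Lottery m) ⊕ AlgState n m) × ℕ → ℝ≥0∞) :
    expect (runFor ε pick I.oracle (t + 1) s) f =
      expect (weightedSample s.w (16 * (m - 1) ^ 2)) fun R =>
        Sum.elim (fun o => f (Sum.inl o, (passOutcome I pick s R).2))
          (fun s' => expect (runFor ε pick I.oracle t s')
            fun z => f (z.1, (passOutcome I pick s R).2 + z.2)) (passOutcome I pick s R).1 := by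
  classical
  rw [runFor, expect_bind, iteration, expect_map]
  congr 1
  funext R
  have hR : (loopBody ε pick (R.image Sigma.fst) s).run I.oracle = passOutcome I pick s R := by
    unfold passOutcome
    congr!
  rw [hR]
  generalize passOutcome I pick s R = z
  obtain ⟨o | s', q⟩ := z
  · simp only [expect_pure, Sum.elim_inl]
  · simp only [expect_map, Sum.elim_inr]

/-- The probability that the algorithm has not returned after `t` iterations. -/
noncomputable def aliveProb (t : ℕ) (s : AlgState n m) : ℝ≥0∞ :=
  expect (runFor ε pick I.oracle t s) fun z => Sum.elim (fun _ => 0) (fun _ => 1) z.1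

theorem aliveProb_zero (s : AlgState n m) : aliveProb I pick 0 s = 1 := by
  rw [aliveProb, expect_runFor_zero, Sum.elim_inr]

theorem aliveProb_succ (t : ℕ) (s : AlgState n m) :
    aliveProb I pick (t + 1) s = expect (weightedSample s.w (16 * (m - 1) ^ 2)) fun R =>
      Sum.elim (fun _ => 0) (fun s' => aliveProb I pick t s') (passOutcome I pick s R).1 := by
  rw [aliveProb, expect_runFor_succ]
  simp only [Sum.elim_inl]
  rfl

theorem aliveProb_le_one (t : ℕ) (s : AlgState n m) : aliveProb I pick t s ≤ 1 := by
  refine (expect_mono _ (g := fun _ => 1) fun z => ?_).trans_eq (expect_const _ _)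
  obtain ⟨o | s', q⟩ := z <;> simp

/-- `LearnHyperplane` is correct for every agent and makes at most `L` queries. -/
def LearnsWithin (L : ℕ) : Prop :=
  ∀ i, Describes I i ((learnHyperplane ε pick i).run I.oracle).1 ∧
    ((learnHyperplane ε pick i).run I.oracle).2 ≤ L

variable {L : ℕ}

theorem passOutcome_spec (hL : LearnsWithin I pick L) (s : AlgState n m) (hs : s.Sound I)
    (R : Finset (Σ i : Fin n, Fin (s.w i))) :
    (passOutcome I pick s R).2 ≤ n + L * R.card ∧
    (passOutcome I pick s R).2 ≤ n + L * s.unknown.card ∧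
    (∀ o, (passOutcome I pick s R).1 = Sum.inl o → I.CorrectOutput o) ∧
    ∀ s', (passOutcome I pick s R).1 = Sum.inr s' →
      s'.Sound I ∧ (passOutcome I pick s R).2 + L * s'.unknown.card ≤ n + L * s.unknown.card ∧
      ∃ x, IsLexMax (I.feasible (R.image Sigma.fst)) x ∧ ¬ I.Unanimous x ∧
        ∀ i, s'.w i = if I.oracle i x = true then s.w i else 2 * s.w i := by
  obtain ⟨h1, h2, h3, h4⟩ := loopBody_spec I (L := L) (Nat.cast_nonneg L)
    (fun i => ⟨(hL i).1, Nat.cast_le.2 (hL i).2⟩) (R.image Sigma.fst) s hs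
  refine ⟨?_, ?_, h3, fun s' hs' => ?_⟩
  · have h : (passOutcome I pick s R).2 ≤ n + L * (R.image Sigma.fst).card := by exact_mod_cast h1
    refine h.trans ?_
    gcongr
    exact Finset.card_image_le
  · exact_mod_cast h2
  · obtain ⟨g1, g2, g3⟩ := h4 s' hs'
    exact ⟨g1, by exact_mod_cast g2, g3⟩

/-- Each pass that starts pays `n` for verification, and pass `k + 1` starts exactly when the run is
alive after `k` passes. Learning is paid by the potential `L * s.unknown.card`. -/
theorem expect_queries_le (hL : LearnsWithin I pick L) (t : ℕ) (s : AlgState n m) (hs : s.Sound I) :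
    (expect (runFor ε pick I.oracle t s) fun z => (z.2 : ℝ≥0∞)) ≤
      n * ∑ k ∈ Finset.range t, aliveProb I pick k s + L * s.unknown.card := by
  induction t generalizing s with
  | zero => rw [expect_runFor_zero]; simp
  | succ t ih =>
    rw [expect_runFor_succ, Finset.sum_range_succ', aliveProb_zero]
    simp only [aliveProb_succ]
    rw [← expect_sum]
    have e : (n : ℝ≥0∞) * (expect (weightedSample s.w (16 * (m - 1) ^ 2)) (fun R =>
        ∑ k ∈ Finset.range t, Sum.elim (fun _ => 0) (fun s' => aliveProb I pick k s')
          (passOutcome I pick s R).1) + 1) + L * s.unknown.card =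
        expect (weightedSample s.w (16 * (m - 1) ^ 2)) fun R =>
          (n : ℝ≥0∞) * (∑ k ∈ Finset.range t, Sum.elim (fun _ => 0)
            (fun s' => aliveProb I pick k s') (passOutcome I pick s R).1)
            + (n + L * s.unknown.card) := by
      rw [expect_add, expect_mul_left, expect_const]
      ring
    rw [e]
    refine expect_mono _ fun R => ?_
    obtain ⟨-, h2, -, h4⟩ := passOutcome_spec I pick hL s hs R
    generalize passOutcome I pick s R = z at h2 h4 ⊢
    obtain ⟨o | s', q⟩ := z
    · simp only [Sum.elim_inl, Finset.sum_const_zero, mul_zero, zero_add]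
      exact_mod_cast h2
    · simp only [Sum.elim_inr]
      obtain ⟨g1, g2, -⟩ := h4 s' rfl
      simp only at g2
      simp only [Nat.cast_add, expect_add, expect_const]
      calc (q : ℝ≥0∞) + _ ≤ q + (n * ∑ k ∈ Finset.range t, aliveProb I pick k s'
            + L * s'.unknown.card) := by gcongr; exact ih s' g1
        _ = n * ∑ k ∈ Finset.range t, aliveProb I pick k s' + (q + L * s'.unknown.card) := by ring
        _ ≤ _ := by
          refine add_le_add_right ?_ _
          exact_mod_cast g2

/-- The other charge: each pass pays as if all of its sampled copies were agents to be learned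
afresh. -/
theorem expect_queries_le' (hL : LearnsWithin I pick L) (t : ℕ) (s : AlgState n m) (hs : s.Sound I) :
    (expect (runFor ε pick I.oracle t s) fun z => (z.2 : ℝ≥0∞)) ≤
      (n + L * (16 * (m - 1) ^ 2 : ℕ)) * ∑ k ∈ Finset.range t, aliveProb I pick k s := by
  classical
  induction t generalizing s with
  | zero => rw [expect_runFor_zero]; simp
  | succ t ih =>
    rw [expect_runFor_succ, Finset.sum_range_succ', aliveProb_zero]
    simp only [aliveProb_succ]
    rw [← expect_sum, mul_add, mul_one, ← expect_mul_left]
    set c : ℝ≥0∞ := n + L * (16 * (m - 1) ^ 2 : ℕ) with hc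
    rw [← expect_const (weightedSample s.w (16 * (m - 1) ^ 2)) c, ← expect_add, expect_const]
    refine expect_mono_support _ fun R hR => ?_
    rw [weightedSample, PMF.mem_support_uniformOfFinset_iff] at hR
    obtain ⟨h1, -, -, h4⟩ := passOutcome_spec I pick hL s hs R
    have hq : ((passOutcome I pick s R).2 : ℝ≥0∞) ≤ c := by
      have hRc : R.card ≤ 16 * (m - 1) ^ 2 :=
        (Finset.mem_powersetCard.1 hR).2.trans_le (min_le_left _ _)
      have : (passOutcome I pick s R).2 ≤ n + L * (16 * (m - 1) ^ 2) :=
        h1.trans (by gcongr)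
      rw [hc]
      exact_mod_cast this
    generalize passOutcome I pick s R = z at hq h4 ⊢
    obtain ⟨o | s', q⟩ := z
    · simp only [Sum.elim_inl, Finset.sum_const_zero, mul_zero, zero_add]
      exact hq
    · simp only [Sum.elim_inr]
      obtain ⟨g1, -, -⟩ := h4 s' rfl
      have := ih s' g1
      simp only [Nat.cast_add]
      rw [expect_add, expect_const, add_comm]
      exact add_le_add this hq

/-- Doubling adds the weight of the violators, which the sampling lemma controls; runs that return
count as `0`, so no conditioning is needed. -/
theorem expect_weight_succ_le (hL : LearnsWithin I pick L) (hm : 2 ≤ m) (s : AlgState n m) (hs : s.Sound I) :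
    (expect (weightedSample s.w (16 * (m - 1) ^ 2)) fun R =>
      Sum.elim (fun _ => 0) (fun s' => ((∑ i, s'.w i : ℕ) : ℝ≥0∞)) (passOutcome I pick s R).1) ≤
      (1 + (4 * m : ℝ≥0∞)⁻¹) * (∑ i, s.w i : ℕ) := by
  classical
  rw [add_mul, one_mul]
  refine le_trans ?_ (add_le_add_right (expect_violatedWeight_le I hm s.w) _)
  rw [← expect_const (weightedSample s.w (16 * (m - 1) ^ 2)) ((∑ i, s.w i : ℕ) : ℝ≥0∞),
    ← expect_add]
  refine expect_mono _ fun R => ?_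
  obtain ⟨-, -, -, h4⟩ := passOutcome_spec I pick hL s hs R
  generalize passOutcome I pick s R = z at h4 ⊢
  obtain ⟨o | s', q⟩ := z
  · simp
  · obtain ⟨-, -, x, hx, -, hw⟩ := h4 s' rfl
    simp only [Sum.elim_inr]
    rw [← Nat.cast_add, Nat.cast_le, violatedWeight, ← Finset.sum_add_distrib]
    refine Finset.sum_le_sum fun i _ => ?_
    rw [hw]
    split_ifs with ho hv hv
    · omega
    · omega
    · omega
    · exact absurd ⟨x, hx, fun h => ho (I.oracle_eq_true.2 h)⟩ hv

/-- The product of the weights of a set that every unsuccessful iteration hits doubles in each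
iteration, while the total weight grows by a factor of `1 + 1 / (4 m)` in expectation. -/
theorem aliveProb_potential (hL : LearnsWithin I pick L) (hm : 2 ≤ m) {B : Finset (Fin n)} (hB : B.Nonempty)
    (hBv : ∀ N' x, IsLexMax (I.feasible N') x → ¬ I.Unanimous x → ∃ b ∈ B, x ∉ I.accepted b)
    {c : ℝ≥0∞} (hc : c ^ B.card ≤ 2) (t : ℕ) (s : AlgState n m) (hs : s.Sound I) (y : ℝ≥0∞)
    (hy : y ^ B.card ≤ ∏ b ∈ B, (s.w b : ℝ≥0∞)) :
    aliveProb I pick t s * (c ^ t * y) ≤ (1 + (4 * m : ℝ≥0∞)⁻¹) ^ t * (∑ i, s.w i : ℕ) := by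
  induction t generalizing s y with
  | zero =>
    rw [aliveProb_zero, pow_zero, pow_zero, one_mul, one_mul, one_mul]
    -- The geometric mean over the nonempty set `B` is at most the total weight.
    rw [← ENNReal.pow_le_pow_left_iff (Finset.card_ne_zero.2 hB)]
    refine hy.trans (Finset.prod_le_pow_card _ _ _ fun b _ => ?_)
    exact_mod_cast Finset.single_le_sum (f := s.w) (fun _ _ => Nat.zero_le _) (Finset.mem_univ b)
  | succ t ih =>
    calc aliveProb I pick (t + 1) s * (c ^ (t + 1) * y)
        = (c ^ t * (c * y)) * aliveProb I pick (t + 1) s := by ring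
      _ = expect (weightedSample s.w (16 * (m - 1) ^ 2)) fun R => (c ^ t * (c * y)) *
            Sum.elim (fun _ => 0) (fun s' => aliveProb I pick t s') (passOutcome I pick s R).1 := by
          rw [aliveProb_succ, expect_mul_left]
      _ ≤ expect (weightedSample s.w (16 * (m - 1) ^ 2)) fun R => (1 + (4 * m : ℝ≥0∞)⁻¹) ^ t *
            Sum.elim (fun _ => 0) (fun s' => ((∑ i, s'.w i : ℕ) : ℝ≥0∞))
              (passOutcome I pick s R).1 := by
          refine expect_mono _ fun R => ?_
          obtain ⟨-, -, -, h4⟩ := passOutcome_spec I pick hL s hs R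
          generalize passOutcome I pick s R = z at h4 ⊢
          obtain ⟨o | s', q⟩ := z
          · simp
          · obtain ⟨g1, -, x, hx, hxu, hw⟩ := h4 s' rfl
            simp only [Sum.elim_inr]
            rw [mul_comm]
            -- `y` is a running lower bound for the geometric mean over `B`; a failed pass doubles
            -- the product and so raises it by `c`.
            refine ih s' g1 (c * y) ?_
            obtain ⟨b, hbB, hbx⟩ := hBv _ x hx hxu
            have hprod : 2 * ∏ b ∈ B, s.w b ≤ ∏ b ∈ B, s'.w b := by
              rw [← Finset.mul_prod_erase _ _ hbB, ← Finset.mul_prod_erase B s'.w hbB, ← mul_assoc]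
              refine Nat.mul_le_mul ?_ (Finset.prod_le_prod' fun i _ => ?_)
              · rw [hw, if_neg (mt I.oracle_eq_true.1 hbx)]
              · rw [hw]
                split_ifs <;> omega
            calc (c * y) ^ B.card = c ^ B.card * y ^ B.card := mul_pow _ _ _
              _ ≤ 2 * ∏ b ∈ B, (s.w b : ℝ≥0∞) := mul_le_mul' hc hy
              _ ≤ ∏ b ∈ B, (s'.w b : ℝ≥0∞) := by exact_mod_cast hprod
      _ ≤ (1 + (4 * m : ℝ≥0∞)⁻¹) ^ t * ((1 + (4 * m : ℝ≥0∞)⁻¹) * (∑ i, s.w i : ℕ)) := by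
          rw [expect_mul_left]
          gcongr
          exact expect_weight_succ_le I pick hL hm s hs
      _ = _ := by ring

/-- By induction over the passes, the expected indicator of any given incorrect output is `0`. -/
theorem correct_of_runFor_ne_zero (hL : LearnsWithin I pick L) (t : ℕ) (s : AlgState n m)
    (hs : s.Sound I) (o : Option (Lottery m)) (q : ℕ)
    (h : runFor ε pick I.oracle t s (Sum.inl o, q) ≠ 0) : I.CorrectOutput o := by
  classical
  by_contra ho
  have key : (expect (runFor ε pick I.oracle t s) fun z =>
      Sum.elim (fun o' => if o' = o then 1 else 0) (fun _ => 0) z.1) ≤ 0 := by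
    clear h q
    induction t generalizing s with
    | zero => rw [expect_runFor_zero, Sum.elim_inr]
    | succ t ih =>
      rw [expect_runFor_succ]
      refine (expect_mono _ (g := fun _ => 0) fun R => ?_).trans_eq (expect_const _ _)
      obtain ⟨-, -, h3, h4⟩ := passOutcome_spec I pick hL s hs R
      generalize passOutcome I pick s R = z at h3 h4 ⊢
      obtain ⟨o' | s', q⟩ := z
      · have : o' ≠ o := by
          rintro rfl
          exact ho (h3 _ rfl)
        simp [this]
      · exact ih s' (h4 s' rfl).1
  have hle := (ENNReal.le_tsum (f := fun z => runFor ε pick I.oracle t s z *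
    Sum.elim (fun o' => if o' = o then (1 : ℝ≥0∞) else 0) (fun _ => 0) z.1) (Sum.inl o, q)).trans key
  simp only [Sum.elim_inl, if_true, mul_one] at hle
  exact h (le_antisymm hle bot_le)

end Potential

/-! ### The advice and the initial weights -/

section Advice

variable {n m : ℕ} {ε : ℝ} (I : UtilityInstance n m ε) (σ : Equiv.Perm (Fin n))

theorem rank_le (i : Fin n) : rank σ i ≤ n := (σ.symm i).2

theorem one_le_rank (i : Fin n) : 1 ≤ rank σ i := Nat.le_add_left 1 _

theorem prefixWitness_spec (hn : 1 ≤ n) (hm : 1 ≤ m) :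
    1 ≤ I.prefixWitness σ ∧ I.prefixWitness σ ≤ n ∧
      ∃ B, I.IsWitnessSet B ∧ ∀ i ∈ B, rank σ i ≤ I.prefixWitness σ := by
  obtain ⟨B, hB⟩ := I.exists_isWitnessSet hm
  have hmem : n ∈ {k | 1 ≤ k ∧ ∃ B, I.IsWitnessSet B ∧ ∀ i ∈ B, rank σ i ≤ k} :=
    ⟨hn, B, hB, fun i _ => rank_le σ i⟩
  obtain ⟨h1, h2⟩ := Nat.sInf_mem ⟨n, hmem⟩
  exact ⟨h1, Nat.sInf_le hmem, h2⟩

/-- The first `E(σ)` agents contain a nonempty set of at most `m` agents that is hit by the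
violators of every unsuccessful iteration. -/
theorem exists_hitting_set (hn : 1 ≤ n) (hm : 1 ≤ m) :
    ∃ B : Finset (Fin n), B.Nonempty ∧ B.card ≤ m ∧ (∀ b ∈ B, rank σ b ≤ I.prefixWitness σ) ∧
      ∀ N' x, IsLexMax (I.feasible N') x → ¬ I.Unanimous x → ∃ b ∈ B, x ∉ I.accepted b := by
  obtain ⟨hE, -, B, hB, hBr⟩ := prefixWitness_spec I σ hn hm
  have hhit : ∀ N' x, IsLexMax (I.feasible N') x → ¬ I.Unanimous x → ∃ b ∈ B, x ∉ I.accepted b := by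
    intro N' x hx hxu
    by_contra! hcon
    exact hxu (hB.unanimous hx hcon)
  rcases B.eq_empty_or_nonempty with rfl | hne
  -- An empty witness set means that no pass can fail. The first agent of `σ` replaces it, because
  -- the geometric mean needs a nonempty set; its rank is `1 ≤ E(σ)`.
  · refine ⟨{σ ⟨0, hn⟩}, Finset.singleton_nonempty _, by simpa using hm, fun b hb => ?_,
      fun N' x hx hxu => ?_⟩
    · rw [Finset.mem_singleton.1 hb]
      simpa [rank] using hE
    · obtain ⟨b, hb, -⟩ := hhit N' x hx hxu
      exact absurd hb (Finset.notMem_empty b)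
  · exact ⟨B, hne, hB.card_le hm, hBr, hhit⟩

theorem initState_sound : (initState m σ).Sound I := fun i hi => by simp [initState] at hi

theorem card_unknown_initState : (initState m σ).unknown.card = n := by
  simp [AlgState.unknown, initState]

/-- A harmonic sum, plus at most `1` per agent for rounding up. -/
theorem sum_initState_le (hn : 1 ≤ n) :
    ((∑ i, (initState m σ).w i : ℕ) : ℝ) ≤ n * (Real.log n + 2) := by
  have h1 : ∀ i, (((initState m σ).w i : ℕ) : ℝ) ≤ n / (rank σ i : ℝ) + 1 := fun i =>
    (Nat.ceil_lt_add_one (by positivity)).le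
  have h2 : ∑ i, ((n : ℝ) / (rank σ i : ℝ)) = n * harmonic n := by
    simp only [rank]
    rw [Equiv.sum_comp σ.symm (fun j : Fin n => (n : ℝ) / (((j : ℕ) + 1 : ℕ) : ℝ)),
      Fin.sum_univ_eq_sum_range (fun j => (n : ℝ) / ((j + 1 : ℕ) : ℝ)), harmonic, Rat.cast_sum,
      Finset.mul_sum]
    exact Finset.sum_congr rfl fun j _ => by push_cast; rw [div_eq_mul_inv]
  rw [Nat.cast_sum]
  calc ∑ i, (((initState m σ).w i : ℕ) : ℝ) ≤ ∑ i, (n / (rank σ i : ℝ) + 1) :=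
        Finset.sum_le_sum fun i _ => h1 i
    _ = n * harmonic n + n := by rw [Finset.sum_add_distrib, h2]; simp
    _ ≤ n * (1 + Real.log n) + n := by
        gcongr
        exact harmonic_le_one_add_log n
    _ = _ := by ring

theorem aliveProb_initState_le {pick : Finset (Fin m) → Fin m} {L : ℕ}
    (hL : LearnsWithin I pick L) (hn : 1 ≤ n) (hm : 2 ≤ m) (t : ℕ) :
    aliveProb I pick t (initState m σ) ≤ ENNReal.ofReal
      (I.prefixWitness σ * (Real.log n + 2) * Real.exp (-(t * (1 / (4 * m))))) := by
  obtain ⟨B, hBne, hBm, hBr, hBhit⟩ := exists_hitting_set I σ hn (by omega)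
  obtain ⟨hE, -, -⟩ := prefixWitness_spec I σ hn (by omega)
  set E := I.prefixWitness σ
  have hE0 : (0 : ℝ) < E := by exact_mod_cast hE
  have hn0 : (0 : ℝ) < n := by exact_mod_cast hn
  have hm0 : (0 : ℝ) < m := by exact_mod_cast (by omega : 0 < m)
  -- The rate `1/(2m)` is small enough since `1/2 < log 2`, and it is twice the rate `1/(4m)` of the
  -- total weight, so the quotient still decays at rate `1/(4m)`.
  have hc : ENNReal.ofReal (Real.exp (1 / (2 * m))) ^ B.card ≤ 2 := by
    rw [← ENNReal.ofReal_pow (Real.exp_nonneg _), ← Real.exp_nat_mul]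
    refine ENNReal.ofReal_le_of_le_toReal ?_
    rw [ENNReal.toReal_ofNat]
    calc Real.exp (B.card * (1 / (2 * m))) ≤ Real.exp (Real.log 2) := by
          refine Real.exp_le_exp.2 ?_
          have : (B.card : ℝ) * (1 / (2 * m)) ≤ m * (1 / (2 * m)) := by gcongr
          have h2 : (m : ℝ) * (1 / (2 * m)) = 1 / 2 := by field_simp
          linarith [Real.log_two_gt_d9]
      _ = 2 := Real.exp_log two_pos
  have hy : ENNReal.ofReal (n / E) ^ B.card ≤ ∏ b ∈ B, ((initState m σ).w b : ℝ≥0∞) := by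
    refine Finset.pow_card_le_prod _ _ _ fun b hb => ?_
    refine ENNReal.ofReal_le_of_le_toReal ?_
    rw [ENNReal.toReal_natCast]
    refine le_trans ?_ (Nat.le_ceil _)
    have := one_le_rank σ b
    gcongr
    exact hBr b hb
  have key := aliveProb_potential I pick hL hm hBne hBhit hc t (initState m σ)
    (initState_sound I σ) _ hy
  have ha : aliveProb I pick t (initState m σ) ≠ ⊤ :=
    ne_top_of_le_ne_top ENNReal.one_ne_top (aliveProb_le_one I pick t _)
  rw [ENNReal.le_ofReal_iff_toReal_le ha (by
    have := Real.log_nonneg (by exact_mod_cast hn : (1 : ℝ) ≤ n)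
    positivity)]
  have hβ : (1 + (4 * m : ℝ≥0∞)⁻¹) = ENNReal.ofReal (1 + 1 / (4 * m)) := by
    rw [ENNReal.ofReal_add zero_le_one (by positivity), ENNReal.ofReal_one, one_div,
      ENNReal.ofReal_inv_of_pos (by positivity), ENNReal.ofReal_mul (by norm_num)]
    simp
  rw [hβ] at key
  have hfin : ENNReal.ofReal (1 + 1 / (4 * m)) ^ t * ((∑ i, (initState m σ).w i : ℕ) : ℝ≥0∞) ≠ ⊤ :=
    ENNReal.mul_ne_top (ENNReal.pow_ne_top ENNReal.ofReal_ne_top) (ENNReal.natCast_ne_top _)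
  have keyR := ENNReal.toReal_mono hfin key
  rw [ENNReal.toReal_mul, ENNReal.toReal_mul, ENNReal.toReal_mul, ENNReal.toReal_pow,
    ENNReal.toReal_pow, ENNReal.toReal_ofReal (Real.exp_nonneg _),
    ENNReal.toReal_ofReal (by positivity), ENNReal.toReal_ofReal (by positivity),
    ENNReal.toReal_natCast, ← Real.exp_nat_mul] at keyR
  set a := (aliveProb I pick t (initState m σ)).toReal
  have hW := sum_initState_le (m := m) σ hn
  have hpow : (1 + 1 / (4 * m : ℝ)) ^ t ≤ Real.exp (t * (1 / (4 * m))) := by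
    rw [Real.exp_nat_mul]
    gcongr
    rw [add_comm]
    exact Real.add_one_le_exp _
  have hexp : Real.exp (t * (1 / (2 * m))) =
      Real.exp (t * (1 / (4 * m))) * Real.exp (t * (1 / (4 * m))) := by
    rw [← Real.exp_add]
    congr 1
    field_simp
    ring
  have h3 : a * (Real.exp (t * (1 / (2 * m))) * (n / E)) ≤
      Real.exp (t * (1 / (4 * m))) * (n * (Real.log n + 2)) :=
    keyR.trans (mul_le_mul hpow hW (Nat.cast_nonneg _) (Real.exp_nonneg _))
  rw [hexp] at h3
  rw [Real.exp_neg, ← div_eq_mul_inv, le_div_iff₀ (Real.exp_pos _)]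
  have hx := Real.exp_pos (t * (1 / (4 * m : ℝ)))
  set X := Real.exp (t * (1 / (4 * m : ℝ)))
  have h4 : (X * n / E) * (a * X) ≤ (X * n / E) * (E * (Real.log n + 2)) := by
    calc (X * n / E) * (a * X) = a * (X * X * (n / E)) := by ring
      _ ≤ X * (n * (Real.log n + 2)) := h3
      _ = _ := by field_simp
  exact le_of_mul_le_mul_left h4 (by positivity)

/-- The first `⌈log M / x⌉` terms are bounded by `1`. After that a geometric series takes over, with
sum at most `1 + 1/x` because `exp(-x) ≤ 1/(1 + x)`. -/
theorem sum_min_geometric_le {M x : ℝ} (hM : 1 ≤ M) (hx : 0 < x) {f : ℕ → ℝ}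
    (h1 : ∀ k, f k ≤ 1) (h0 : ∀ k, 0 ≤ f k) (h : ∀ k : ℕ, f k ≤ M * Real.exp (-(k * x))) (t : ℕ) :
    ∑ k ∈ Finset.range t, f k ≤ (Real.log M + 1) / x + 2 := by
  have hlog : 0 ≤ Real.log M := Real.log_nonneg hM
  set k₀ := ⌈Real.log M / x⌉₊
  have hk₀ : (k₀ : ℝ) ≤ Real.log M / x + 1 := (Nat.ceil_lt_add_one (by positivity)).le
  have hk₀' : Real.log M ≤ k₀ * x := by
    rw [← div_le_iff₀ hx]
    exact Nat.le_ceil _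
  have hq0 : 0 ≤ Real.exp (-x) := Real.exp_nonneg _
  have hq : Real.exp (-x) ≤ 1 / (1 + x) := by
    rw [Real.exp_neg, ← one_div]
    exact one_div_le_one_div_of_le (by positivity) (by linarith [Real.add_one_le_exp x])
  have hq1 : 1 / (1 + x) < 1 := by rw [div_lt_one (by positivity)]; linarith
  calc ∑ k ∈ Finset.range t, f k ≤ ∑ k ∈ Finset.range (k₀ + t), f k :=
        Finset.sum_le_sum_of_subset_of_nonneg (Finset.range_mono (Nat.le_add_left _ _))
          fun k _ _ => h0 k
    _ = ∑ k ∈ Finset.range k₀, f k + ∑ j ∈ Finset.range t, f (k₀ + j) :=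
        Finset.sum_range_add _ _ _
    _ ≤ k₀ + (1 - Real.exp (-x))⁻¹ := by
        refine add_le_add ((Finset.sum_le_sum fun k _ => h1 k).trans_eq (by simp)) ?_
        calc ∑ j ∈ Finset.range t, f (k₀ + j) ≤ ∑ j ∈ Finset.range t, Real.exp (-x) ^ j := by
              refine Finset.sum_le_sum fun j _ => (h _).trans ?_
              rw [← Real.exp_nat_mul, ← Real.exp_log (lt_of_lt_of_le one_pos hM), ← Real.exp_add]
              refine Real.exp_le_exp.2 ?_
              push_cast
              nlinarith
          _ ≤ ∑' j, Real.exp (-x) ^ j :=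
              (summable_geometric_of_lt_one hq0 (hq.trans_lt hq1)).sum_le_tsum _
                fun j _ => pow_nonneg hq0 j
          _ = _ := tsum_geometric_of_lt_one hq0 (hq.trans_lt hq1)
    _ ≤ (Real.log M / x + 1) + (1 + 1 / x) := by
        refine add_le_add hk₀ ?_
        rw [show 1 + 1 / x = (1 - 1 / (1 + x))⁻¹ by
          have : 1 - 1 / (1 + x) = x / (1 + x) := by field_simp; ring
          rw [this, inv_div]; field_simp; ring]
        exact inv_anti₀ (by linarith) (by linarith)
    _ = _ := by ring

/-- A positive `μ` is bounded away from `0`, so additive constants can be absorbed. For `n ≥ 3` this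
comes from `log n ≥ 1.05`; for `n = 2` positivity forces `E = 2`; for `n = 1` it is impossible. -/
theorem adviceMu_pos_lower (hn : 1 ≤ n) (hm : 1 ≤ m) (hμ : 0 < I.adviceMu σ) :
    2 ≤ n ∧ 1 / 25 ≤ I.adviceMu σ := by
  obtain ⟨hE, hEn, -⟩ := prefixWitness_spec I σ hn hm
  unfold UtilityInstance.adviceMu at hμ ⊢
  set E := I.prefixWitness σ
  have hE1 : (1 : ℝ) ≤ E := by exact_mod_cast hE
  have hlE := Real.log_nonneg hE1
  rcases Nat.lt_or_ge n 3 with h3 | h3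
  · have hn12 : n = 1 ∨ n = 2 := by omega
    rcases hn12 with rfl | rfl
    · have : E = 1 := by omega
      rw [this] at hμ
      simp at hμ
    · refine ⟨le_rfl, ?_⟩
      have l1 := Real.log_two_gt_d9
      have l2 := Real.log_two_lt_d9
      have hE12 : E = 1 ∨ E = 2 := by omega
      rcases hE12 with h | h
      · rw [h] at hμ
        have := Real.log_nonpos (x := Real.log 2) (by linarith) (by linarith)
        simp only [Nat.cast_one, Real.log_one, Nat.cast_ofNat, zero_add] at hμ
        linarith
      · rw [h]
        have := Real.one_sub_inv_le_log_of_pos (x := Real.log 2) (by linarith)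
        have h5 : (Real.log 2)⁻¹ ≤ 3 / 2 := by
          rw [inv_le_comm₀ (by linarith) (by norm_num)]
          norm_num
          linarith
        simp only [Nat.cast_ofNat]
        linarith
  · refine ⟨by omega, ?_⟩
    have h1 : (1.05 : ℝ) ≤ Real.log n := by
      have hn3 : (3 : ℝ) ≤ n := by exact_mod_cast h3
      rw [Real.le_log_iff_exp_le (by linarith)]
      refine le_trans ?_ hn3
      have e1 := Real.exp_one_lt_d9
      have e2 : Real.exp 0.05 ≤ 1 / 0.95 := by
        rw [← neg_neg (0.05 : ℝ), Real.exp_neg, ← one_div]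
        refine one_div_le_one_div_of_le (by norm_num) ?_
        have := Real.add_one_le_exp (-0.05 : ℝ)
        norm_num at this ⊢
        linarith
      calc Real.exp 1.05 = Real.exp 1 * Real.exp 0.05 := by rw [← Real.exp_add]; norm_num
        _ ≤ 2.7182818286 * (1 / 0.95) := by gcongr
        _ ≤ 3 := by norm_num
    have h2 := Real.one_sub_inv_le_log_of_pos (x := Real.log n) (by linarith)
    have h5 : (Real.log n)⁻¹ ≤ 1 / 1.05 := by
      rw [← one_div]
      exact one_div_le_one_div_of_le (by norm_num) h1
    norm_num at h5
    linarith

theorem sum_aliveProb_le {pick : Finset (Fin m) → Fin m} {L : ℕ}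
    (hL : LearnsWithin I pick L) (hn : 1 ≤ n) (hm : 2 ≤ m) (hμ : 0 < I.adviceMu σ) (t : ℕ) :
    ∑ k ∈ Finset.range t, aliveProb I pick k (initState m σ) ≤
      ENNReal.ofReal (404 * m * I.adviceMu σ) := by
  obtain ⟨hn2, hμ25⟩ := adviceMu_pos_lower I σ hn (by omega) hμ
  obtain ⟨hE, -, -⟩ := prefixWitness_spec I σ hn (by omega)
  have hm2 : (2 : ℝ) ≤ m := by exact_mod_cast hm
  have hE1 : (1 : ℝ) ≤ I.prefixWitness σ := by exact_mod_cast hE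
  have hn2' : (2 : ℝ) ≤ n := by exact_mod_cast hn2
  have hlogn : 0.69 ≤ Real.log n :=
    le_trans (by linarith [Real.log_two_gt_d9]) (Real.log_le_log two_pos hn2')
  have ha : ∀ k, aliveProb I pick k (initState m σ) ≠ ⊤ := fun k =>
    ne_top_of_le_ne_top ENNReal.one_ne_top (aliveProb_le_one I pick k _)
  have hM : 1 ≤ (I.prefixWitness σ : ℝ) * (Real.log n + 2) := by nlinarith
  rw [ENNReal.le_ofReal_iff_toReal_le (ENNReal.sum_ne_top.2 fun k _ => ha k) (by positivity),
    ENNReal.toReal_sum fun k _ => ha k]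
  refine (sum_min_geometric_le (f := fun k => (aliveProb I pick k (initState m σ)).toReal)
    hM (x := 1 / (4 * m)) (by positivity)
    (fun k => ENNReal.toReal_le_of_le_ofReal zero_le_one
      (by simpa using aliveProb_le_one I pick k (initState m σ)))
    (fun k => ENNReal.toReal_nonneg) (fun k => ENNReal.toReal_le_of_le_ofReal (by positivity)
      (aliveProb_initState_le I σ hL hn hm k)) t).trans ?_
  have hlogM : Real.log (I.prefixWitness σ * (Real.log n + 2)) ≤ I.adviceMu σ + 2 := by
    calc Real.log (I.prefixWitness σ * (Real.log n + 2))
        ≤ Real.log (I.prefixWitness σ * (4 * Real.log n)) := by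
          refine Real.log_le_log (by positivity) ?_
          gcongr
          linarith
      _ = Real.log (I.prefixWitness σ) + (Real.log 4 + Real.log (Real.log n)) := by
          rw [Real.log_mul (by positivity) (by positivity), Real.log_mul (by norm_num) (by positivity)]
      _ ≤ _ := by
          have : Real.log 4 = 2 * Real.log 2 := by
            rw [show (4 : ℝ) = 2 ^ 2 by norm_num, Real.log_pow]; norm_num
          unfold UtilityInstance.adviceMu
          linarith [Real.log_two_lt_d9]
  -- What remains is `4 m (μ + 3) + 2 ≤ 404 m μ`, where `μ ≥ 1/25` gives `400 m μ ≥ 16 m ≥ 12 m +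
  -- 2`.
  rw [div_div_eq_mul_div, div_one]
  nlinarith

end Advice

/-! ### The law of the outcome -/

section Outcome

variable {n m : ℕ} {ε : ℝ} (I : UtilityInstance n m ε) (pick : Finset (Fin m) → Fin m)

/-- Terminated runs stay terminated. A general `g` lets the induction absorb the queries of the
first pass. -/
theorem expect_runFor_mono (t : ℕ) (s : AlgState n m) (g : Option (Lottery m) × ℕ → ℝ≥0∞) :
    (expect (runFor ε pick I.oracle t s) fun z => Sum.elim (fun o => g (o, z.2)) (fun _ => 0) z.1) ≤
      expect (runFor ε pick I.oracle (t + 1) s) fun z =>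
        Sum.elim (fun o => g (o, z.2)) (fun _ => 0) z.1 := by
  induction t generalizing s g with
  | zero => rw [expect_runFor_zero, Sum.elim_inr]; exact bot_le
  | succ t ih =>
    rw [expect_runFor_succ, expect_runFor_succ]
    refine expect_mono _ fun R => ?_
    generalize passOutcome I pick s R = z
    obtain ⟨o | s', q⟩ := z
    · exact le_rfl
    · exact ih s' fun w => g (w.1, q + w.2)

/-- Expectations over the terminated runs, as sums over their outputs and numbers of queries. -/
theorem tsum_runFor_inl (t : ℕ) (s : AlgState n m) (g : Option (Lottery m) × ℕ → ℝ≥0∞) :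
    ∑' z : Option (Lottery m) × ℕ, runFor ε pick I.oracle t s (Sum.inl z.1, z.2) * g z =
      expect (runFor ε pick I.oracle t s) fun z =>
        Sum.elim (fun o => g (o, z.2)) (fun _ => 0) z.1 := by
  have hinj : Function.Injective fun z : Option (Lottery m) × ℕ =>
      ((Sum.inl z.1, z.2) : (Option (Lottery m) ⊕ AlgState n m) × ℕ) := by
    rintro ⟨o, q⟩ ⟨o', q'⟩ h
    simpa using h
  unfold expect
  rw [← hinj.tsum_eq]
  · rfl
  · rintro ⟨o | s', q⟩ hz
    · exact ⟨(o, q), rfl⟩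
    · simp at hz

theorem monotone_runFor_inl (s : AlgState n m) (z : Option (Lottery m) × ℕ) :
    Monotone fun t => runFor ε pick I.oracle t s (Sum.inl z.1, z.2) := by
  classical
  refine monotone_nat_of_le_succ fun t => ?_
  have h : ∀ t, runFor ε pick I.oracle t s (Sum.inl z.1, z.2) =
      ∑' z' : Option (Lottery m) × ℕ, runFor ε pick I.oracle t s (Sum.inl z'.1, z'.2) *
        (if z' = z then 1 else 0) := fun t => by
    rw [tsum_eq_single z fun z' hz' => by rw [if_neg hz', mul_zero], if_pos rfl, mul_one]
  rw [h t, h (t + 1), tsum_runFor_inl I pick t s fun z' => if z' = z then 1 else 0,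
    tsum_runFor_inl I pick (t + 1) s fun z' => if z' = z then 1 else 0]
  exact expect_runFor_mono I pick t s fun z' => if z' = z then 1 else 0

/-- Monotone convergence: the masses after `t` passes increase with `t`, so sum and supremum
commute. -/
theorem tsum_outcomeLaw (σ : Equiv.Perm (Fin n)) (g : Option (Lottery m) × ℕ → ℝ≥0∞) :
    ∑' z, outcomeLaw I pick σ z * g z =
      ⨆ t, expect (runFor ε pick I.oracle t (initState m σ)) fun z =>
        Sum.elim (fun o => g (o, z.2)) (fun _ => 0) z.1 := by
  simp only [← tsum_runFor_inl, ENNReal.tsum_eq_iSup_sum, outcomeLaw, ENNReal.iSup_mul]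
  rw [iSup_comm]
  refine iSup_congr fun F => ?_
  rw [ENNReal.finsetSum_iSup_of_monotone]
  exact fun z t t' htt' => mul_le_mul_left (monotone_runFor_inl I pick _ z htt') _

variable {I pick} {L : ℕ} (σ : Equiv.Perm (Fin n))

/-- Terminated and alive mass add up to `1`, and the alive mass decays exponentially, whatever the
sign of `μ`. -/
theorem tsum_outcomeLaw_eq_one (hL : LearnsWithin I pick L) (hn : 1 ≤ n) (hm : 2 ≤ m) :
    ∑' z, outcomeLaw I pick σ z = 1 := by
  have h := tsum_outcomeLaw I pick σ fun _ => 1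
  simp only [mul_one] at h
  rw [h]
  have hsum : ∀ t, (expect (runFor ε pick I.oracle t (initState m σ)) fun z =>
      Sum.elim (fun _ => (1 : ℝ≥0∞)) (fun _ => 0) z.1) + aliveProb I pick t (initState m σ) = 1 := by
    intro t
    rw [aliveProb, ← expect_add]
    refine Eq.trans ?_ (expect_const (runFor ε pick I.oracle t (initState m σ)) 1)
    congr 1
    funext z
    rcases z.1 with o | s' <;> simp
  refine le_antisymm (iSup_le fun t => (hsum t).le.trans' le_self_add) ?_
  have hm0 : (0 : ℝ) < m := by exact_mod_cast (by omega : 0 < m)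
  have hlim : Filter.Tendsto (fun t : ℕ => ENNReal.ofReal (I.prefixWitness σ * (Real.log n + 2) *
      Real.exp (-(t * (1 / (4 * m)))))) Filter.atTop (nhds 0) := by
    rw [← ENNReal.ofReal_zero, ← mul_zero ((I.prefixWitness σ : ℝ) * (Real.log n + 2))]
    refine ENNReal.tendsto_ofReal (Filter.Tendsto.const_mul _ ?_)
    refine Real.tendsto_exp_neg_atTop_nhds_zero.comp ?_
    exact tendsto_natCast_atTop_atTop.atTop_mul_const (by positivity)
  have hlim' := hlim.const_add (⨆ t, expect (runFor ε pick I.oracle t (initState m σ)) fun z =>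
    Sum.elim (fun _ => (1 : ℝ≥0∞)) (fun _ => 0) z.1)
  rw [add_zero] at hlim'
  refine ge_of_tendsto hlim' (Filter.Eventually.of_forall fun t => ?_)
  refine (hsum t).symm.le.trans ?_
  exact add_le_add (le_iSup (fun t => expect (runFor ε pick I.oracle t (initState m σ)) fun z =>
    Sum.elim (fun _ => (1 : ℝ≥0∞)) (fun _ => 0) z.1) t) (aliveProb_initState_le I σ hL hn hm t)

theorem correctOutput_of_outcomeLaw_ne_zero (hL : LearnsWithin I pick L) {o : Option (Lottery m)}
    {q : ℕ} (h : outcomeLaw I pick σ (o, q) ≠ 0) : I.CorrectOutput o := by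
  obtain ⟨t, ht⟩ : ∃ t, runFor ε pick I.oracle t (initState m σ) (Sum.inl o, q) ≠ 0 := by
    by_contra! hcon
    exact h (by simp [outcomeLaw, hcon])
  exact correct_of_runFor_ne_zero I pick hL t _ (initState_sound I σ) o q ht

theorem expected_queries_le (hL : LearnsWithin I pick L) {ℓ : ℝ} (hℓ : (L : ℝ) ≤ 8 * m * ℓ)
    (hn : 1 ≤ n) (hm : 2 ≤ m) (hμ : 0 < I.adviceMu σ) :
    ∑' z, outcomeLaw I pick σ z * (z.2 : ℝ≥0∞) ≤
      ENNReal.ofReal (60000 * ((n : ℝ) * m * I.adviceMu σ +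
        min (n : ℝ) ((m : ℝ) ^ 3 * I.adviceMu σ) * (m * ℓ))) := by
  rw [tsum_outcomeLaw I pick σ fun z => (z.2 : ℝ≥0∞)]
  refine iSup_le fun t => le_trans (expect_mono _ (g := fun z => (z.2 : ℝ≥0∞)) fun z => ?_) ?_
  -- Counting the queries of unfinished runs as well only increases the expectation.
  · rcases z with ⟨o | s', q⟩ <;> simp
  have hs := initState_sound (m := m) I σ
  have h1 := expect_queries_le I pick hL t _ hs
  have h2 := expect_queries_le' I pick hL t _ hs
  rw [card_unknown_initState] at h1
  have hA := sum_aliveProb_le I σ hL hn hm hμ t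
  set μ := I.adviceMu σ
  set A := ∑ k ∈ Finset.range t, aliveProb I pick k (initState m σ)
  have hm2 : (2 : ℝ) ≤ m := by exact_mod_cast hm
  have hn0 : (0 : ℝ) ≤ n := Nat.cast_nonneg n
  have hL0 : (0 : ℝ) ≤ L := Nat.cast_nonneg L
  have hmℓ : 0 ≤ m * ℓ := by linarith
  have hnmμ : 0 ≤ n * m * μ := by positivity
  rcases le_total (n : ℝ) ((m : ℝ) ^ 3 * μ) with h | h
  · rw [min_eq_left h]
    refine h1.trans ?_
    calc (n : ℝ≥0∞) * A + L * n ≤ n * ENNReal.ofReal (404 * m * μ) + L * n := by gcongr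
      _ = ENNReal.ofReal (n * (404 * m * μ) + L * n) := by
          rw [ENNReal.ofReal_add (by positivity) (by positivity), ENNReal.ofReal_mul hn0,
            ENNReal.ofReal_mul hL0, ENNReal.ofReal_natCast, ENNReal.ofReal_natCast]
      _ ≤ _ := by
          refine ENNReal.ofReal_le_ofReal ?_
          have := mul_le_mul_of_nonneg_right hℓ hn0
          nlinarith [mul_nonneg hn0 hmℓ]
  · rw [min_eq_right h]
    refine h2.trans ?_
    calc ((n : ℝ≥0∞) + L * (16 * (m - 1) ^ 2 : ℕ)) * A
        ≤ (n + L * (16 * m ^ 2 : ℕ)) * ENNReal.ofReal (404 * m * μ) := by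
          gcongr
          exact Nat.sub_le _ _
      _ = ENNReal.ofReal ((n + L * (16 * m ^ 2 : ℕ)) * (404 * m * μ)) := by
          rw [ENNReal.ofReal_mul (p := n + L * (16 * m ^ 2 : ℕ)) (by positivity),
            ENNReal.ofReal_add hn0 (by positivity),
            ENNReal.ofReal_mul hL0, ENNReal.ofReal_natCast, ENNReal.ofReal_natCast,
            ENNReal.ofReal_natCast]
      _ ≤ _ := by
          refine ENNReal.ofReal_le_ofReal ?_
          push_cast
          have h3 : (L : ℝ) * (16 * (m : ℝ) ^ 2 * (404 * m * μ)) ≤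
              8 * m * ℓ * (16 * (m : ℝ) ^ 2 * (404 * m * μ)) :=
            mul_le_mul_of_nonneg_right hℓ (by positivity)
          have h4 : 0 ≤ (m : ℝ) ^ 3 * μ * (m * ℓ) := by positivity
          -- The constants multiply to `8 * 16 * 404 = 51712`, below `60000`.
          nlinarith

end Outcome

end Unanimity

/-! ### The main theorem -/

theorem mainTheorem7 :
    ∃ C : ℝ, 0 < C ∧
      ∀ (n m : ℕ) (ε : ℝ), 1 ≤ n → 2 ≤ m → 0 < ε → ε ≤ 1 / 2 → (∃ Q : ℕ, 1 / ε = Q) →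
      ∀ (pick : Finset (Fin m) → Fin m), (∀ s : Finset (Fin m), s.Nonempty → pick s ∈ s) →
      ∀ (I : Unanimity.UtilityInstance n m ε) (σ : Equiv.Perm (Fin n)),
        (∑' z, Unanimity.outcomeLaw I pick σ z = 1) ∧
        (∀ o q, Unanimity.outcomeLaw I pick σ (o, q) ≠ 0 → I.CorrectOutput o) ∧
        (0 < I.adviceMu σ →
          ∑' z, Unanimity.outcomeLaw I pick σ z * (z.2 : ENNReal) ≤
            ENNReal.ofReal (C * ((n : ℝ) * m * I.adviceMu σ +
              min (n : ℝ) ((m : ℝ) ^ 3 * I.adviceMu σ) * (m * Real.log (1 / ε))))) := by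
  refine ⟨60000, by norm_num, ?_⟩
  rintro n m ε hn hm hε hε2 ⟨Q, hQ⟩ pick hpick I σ
  have hspec := fun i => Unanimity.learnHyperplane_spec I hε hε2 hQ hpick i
  have hlog : 0 ≤ Real.log (1 / ε) :=
    Real.log_nonneg (by rw [le_div_iff₀ hε]; linarith)
  have hL : Unanimity.LearnsWithin I pick ⌊8 * m * Real.log (1 / ε)⌋₊ :=
    fun i => ⟨(hspec i).1, Nat.le_floor (hspec i).2⟩
  exact ⟨Unanimity.tsum_outcomeLaw_eq_one σ hL hn hm,
    fun o q h => Unanimity.correctOutput_of_outcomeLaw_ne_zero σ hL h,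
    Unanimity.expected_queries_le σ hL (Nat.floor_le (by positivity)) hn hm⟩
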